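/- Conventions. Manifolds are finite-dimensional, smooth, Hausdorff, second countable and without boundary. A smooth groupoid $G$ has manifolds $G_0$ of objects and $G_1$ of arrows, smooth structure maps, and submersions $s,t:G_1\to G_0$; the composite $gh$ is defined when $s(g)=t(h)$. $G$ is an orbifold groupoid if $s$ is a local diffeomorphism and $(s,t):G_1\to G_0\times G_0$ is proper. It is connected if the quotient space $G_0/G$ is connected. $S_G=\{g: s(g)=t(g)\}$, $S^0_G\subset S_G$ is the set of those $g$ whose induced germ of a diffeomorphism of $G_0$ at $s(g)$ is the germ of the identity, and $S^0_G(x)$ is the group of elements of $S^0_G$ based at $x$. $G$ is purely ineffective if $S^0_G=S_G$. A right action of a Lie group $L$ on $G$ consists of smooth right actions on $G_0$ and $G_1$ compatible with the structure maps; the semidirect product $G\rtimes L$ has objects $G_0$, arrows $G_1\times L$, $s(g,l)=s(g)\cdot l$, $t(g,l)=t(g)$ and $(g,l)(g',l')=(g(g'\cdot l^{-1}),ll')$. An equivalence between smooth groupoids $G$, $H$ is a manifold $P$ with commuting left $G$- and right $H$-actions along smooth maps $s_P:P\to G_0$ and $t_P:P\to H_0$, such that $s_P$ is a principal $H$-bundle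 and $t_P$ is a principal $G$-bundle; it is $K$-equivariant (for right $K$-actions on $G$ and $H$) if $P$ carries a smooth right $K$-action for which $s_P,t_P$ are equivariant and $(gp)\cdot k=(g\cdot k)(p\cdot k)$, $(ph)\cdot k=(p\cdot k)(h\cdot k)$. Proposition. Let $G$ be a connected purely ineffective orbifold groupoid, let $K$ be a Lie group acting on $G$ on the right, let $x\in G_0$, and let $T=S^0_G(x)$ (a finite group). Then there is a purely ineffective orbifold groupoid $G'$ with a right action of $K\times\mathrm{Aut}(T)$ ($\mathrm{Aut}(T)$ being discrete) such that: (1) $G'\rtimes\mathrm{Aut}(T)$, with the $K$-action $(g,\lambda)\cdot k=(g\cdot k,\lambda)$, is $K$-equivariantly equivalent to $G$; (2) the local system of groups $S^0_{G'}$ over $G'_0$ is $(G',K\times\mathrm{Aut}(T))$-equivariantly isomorphic to $G'_0\times Z(T)$. That is, there is a diffeomorphism $c:G'_0\times Z(T)\to S^0_{G'}$ over $G'_0$ (with $Z(T)$ discrete) that is a group isomorphism on each fibre and satisfies $g^{-1}c(t(g),a)g=c(s(g),a)$ for $g\in G'_1$ and $c(y,a)\cdot(k,\lambda)=c(y\cdot(k,\lambda),\lambda^{-1}(a))$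 for $k\in K$, $\lambda\in\mathrm{Aut}(T)$. In particular the groups $S^0_{G'}(y)$ are abelian, and $S^0_{G'}$ is $(G',K)$-equivariantly isomorphic to $G'_0\times Z(T)$ with $K$ acting trivially on $Z(T)$. -/

import Mathlib

open scoped Manifold ContDiff Topology

universe u v w

noncomputable section

/-! ### Manifolds and smooth maps on fibre products -/

/-- A smooth manifold: finite-dimensional, without boundary, Hausdorff and second countable. -/
structure Mfd where
  E : Type
  [normE : NormedAddCommGroup E]
  [spaceE : NormedSpace ℝ E]
  [finE : FiniteDimensional ℝ E]
  H : Type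
  [topH : TopologicalSpace H]
  I : ModelWithCorners ℝ E H
  [bdryless : I.Boundaryless]
  carrier : Type u
  [top : TopologicalSpace carrier]
  [charted : ChartedSpace H carrier]
  [smooth : IsManifold I ∞ carrier]
  [t2 : T2Space carrier]
  [secondCountable : SecondCountableTopology carrier]

namespace Mfd

instance : CoeSort Mfd.{u} (Type u) := ⟨Mfd.carrier⟩

attribute [instance] normE spaceE finE topH bdryless top charted smooth t2 secondCountable

/-- The product manifold. -/
abbrev prod (M : Mfd.{u}) (N : Mfd.{v}) : Mfd.{max u v} where
  E := M.E × N.E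
  H := ModelProd M.H N.H
  I := M.I.prod N.I
  carrier := M × N

/-- The manifold underlying a (Hausdorff, second countable) Lie group. -/
abbrev ofLie {E : Type} [NormedAddCommGroup E] [NormedSpace ℝ E] [FiniteDimensional ℝ E]
    {H : Type} [TopologicalSpace H] (I : ModelWithCorners ℝ E H) [I.Boundaryless]
    (L : Type v) [TopologicalSpace L] [ChartedSpace H L] [Group L] [LieGroup I ∞ L]
    [T2Space L] [SecondCountableTopology L] : Mfd.{v} :=
  haveI : IsManifold I ∞ L := ‹LieGroup I ∞ L›.toIsManifold
  { E := E, H := H, I := I, carrier := L }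

end Mfd

section Smoothness

variable {E E' : Type*} [NormedAddCommGroup E] [NormedSpace ℝ E]
  [NormedAddCommGroup E'] [NormedSpace ℝ E']
  {H H' : Type*} [TopologicalSpace H] [TopologicalSpace H']
  (I : ModelWithCorners ℝ E H) (J : ModelWithCorners ℝ E' H')
  {M N : Type*} [TopologicalSpace M] [ChartedSpace H M] [TopologicalSpace N] [ChartedSpace H' N]

/-- A map defined on a subset `A` of a manifold is smooth if locally it extends to a smooth map
on an open subset of the manifold. If `A` is an embedded submanifold (all fibre products below
are), this is smoothness for the submanifold structure on `A`. -/
def SmoothOnSubset (A : Set M) (f : A → N) : Prop :=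
  ∀ x : A, ∃ U : Set M, IsOpen U ∧ (x : M) ∈ U ∧ ∃ F : M → N,
    ContMDiffOn I J ∞ F U ∧ ∀ y : A, (y : M) ∈ U → F y = f y

/-- A diffeomorphism between two subsets of manifolds. -/
def IsDiffeoOfSubsets {A : Set M} {B : Set N} (f : A → B) : Prop :=
  ∃ e : A ≃ B, (∀ a, e a = f a) ∧ SmoothOnSubset I J A (fun a => (e a : N)) ∧
    SmoothOnSubset J I B (fun b => (e.symm b : M))

/-- A submersion: a smooth map all of whose differentials are surjective. -/
def IsSmoothSubmersion (f : M → N) : Prop :=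
  ContMDiff I J ∞ f ∧ ∀ x, Function.Surjective (mfderiv I J f x)

end Smoothness

/-- The type `A` with the discrete topology, as a zero-dimensional manifold. -/
def Disc (A : Type u) : Type u := A

namespace Disc

instance (A : Type u) : TopologicalSpace (Disc A) := ⊥
instance (A : Type u) : DiscreteTopology (Disc A) := ⟨rfl⟩
instance (A : Type u) [h : Group A] : Group (Disc A) := h
instance (A : Type u) [h : Countable A] : Countable (Disc A) := h

/-- The model of zero-dimensional manifolds. -/
abbrev model : ModelWithCorners ℝ (EuclideanSpace ℝ (Fin 0)) (EuclideanSpace ℝ (Fin 0)) := 𝓡 0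

instance : Unique (EuclideanSpace ℝ (Fin 0)) := ⟨⟨0⟩, fun _ => Subsingleton.elim _ _⟩

instance (A : Type u) : ChartedSpace (EuclideanSpace ℝ (Fin 0)) (Disc A) :=
  ChartedSpace.ofDiscreteTopology

instance (A : Type u) : IsManifold model ∞ (Disc A) := IsManifold.of_discreteTopology _

instance (A : Type u) [Countable A] : SecondCountableTopology (Disc A) := inferInstance

instance (A : Type u) [Group A] : LieGroup model ∞ (Disc A) where
  contMDiff_mul := by
    have : DiscreteTopology (Disc A × Disc A) := inferInstance
    exact contMDiff_of_discreteTopology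
  contMDiff_inv := contMDiff_of_discreteTopology

end Disc

/-! ### Smooth groupoids -/

/-- A smooth groupoid: an arrow `g` goes from `src g` to `tgt g`, and `mul g h` is the composite
`g h`, defined when `src g = tgt h`. -/
structure SmoothGroupoid where
  Obj : Mfd.{u}
  Arr : Mfd.{u}
  src : Arr → Obj
  tgt : Arr → Obj
  unit : Obj → Arr
  inv : Arr → Arr
  mul : (g h : Arr) → src g = tgt h → Arr
  src_unit : ∀ x, src (unit x) = x
  tgt_unit : ∀ x, tgt (unit x) = x
  src_inv : ∀ g, src (inv g) = tgt g
  tgt_inv : ∀ g, tgt (inv g) = src g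
  src_mul : ∀ g h e, src (mul g h e) = src h
  tgt_mul : ∀ g h e, tgt (mul g h e) = tgt g
  mul_assoc : ∀ g h k (e : src g = tgt h) (e' : src h = tgt k),
    mul g (mul h k e') (e.trans (tgt_mul h k e').symm) =
      mul (mul g h e) k ((src_mul g h e).trans e')
  mul_unit : ∀ g, mul g (unit (src g)) (tgt_unit (src g)).symm = g
  unit_mul : ∀ g, mul (unit (tgt g)) g (src_unit (tgt g)) = g
  inv_mul : ∀ g, mul (inv g) g (src_inv g) = unit (src g)
  mul_inv : ∀ g, mul g (inv g) (tgt_inv g).symm = unit (tgt g)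
  smooth_src : ContMDiff Arr.I Obj.I ∞ src
  smooth_tgt : ContMDiff Arr.I Obj.I ∞ tgt
  smooth_unit : ContMDiff Obj.I Arr.I ∞ unit
  smooth_inv : ContMDiff Arr.I Arr.I ∞ inv
  smooth_mul : SmoothOnSubset (Arr.I.prod Arr.I) Arr.I {p : Arr × Arr | src p.1 = tgt p.2}
    (fun p => mul p.1.1 p.1.2 p.2)
  submersion_src : IsSmoothSubmersion Arr.I Obj.I src

namespace SmoothGroupoid

variable (G : SmoothGroupoid.{u})

lemma mul_congr {g g' h h' : G.Arr} (hg : g = g') (hh : h = h') (e : G.src g = G.tgt h)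
    (e' : G.src g' = G.tgt h') : G.mul g h e = G.mul g' h' e' := by
  subst hg hh; rfl

lemma unit_mul' {x : G.Obj} {g : G.Arr} (e : G.src (G.unit x) = G.tgt g) :
    G.mul (G.unit x) g e = g := by
  obtain rfl : x = G.tgt g := by rw [← e, G.src_unit]
  exact G.unit_mul g

lemma mul_unit' {x : G.Obj} {g : G.Arr} (e : G.src g = G.tgt (G.unit x)) :
    G.mul g (G.unit x) e = g := by
  obtain rfl : x = G.src g := by rw [e, G.tgt_unit]
  exact G.mul_unit g

/-- Objects joined by an arrow. -/
def orbitSetoid : Setoid G.Obj where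
  r x y := ∃ g : G.Arr, G.src g = x ∧ G.tgt g = y
  iseqv :=
    { refl := fun x => ⟨G.unit x, G.src_unit x, G.tgt_unit x⟩
      symm := by
        rintro x y ⟨g, rfl, rfl⟩
        exact ⟨G.inv g, G.src_inv g, G.tgt_inv g⟩
      trans := by
        rintro x y z ⟨g, rfl, rfl⟩ ⟨h, hs, rfl⟩
        exact ⟨G.mul h g hs, G.src_mul .., G.tgt_mul ..⟩ }

/-- The coarse quotient, with the quotient topology. -/
abbrev Coarse : Type u := Quotient G.orbitSetoid

/-- A groupoid is connected if its coarse quotient is. -/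
def IsConnected : Prop := ConnectedSpace G.Coarse

/-- Étale groupoids. -/
class IsEtale : Prop where
  etale : IsLocalDiffeomorph G.Arr.I G.Obj.I ∞ G.src

/-- Orbifold groupoids: smooth proper étale groupoids. -/
class IsOrbifold : Prop extends G.IsEtale where
  proper : IsProperMap (fun g : G.Arr => (G.src g, G.tgt g))

/-! ### Stabilizers -/

/-- The space of all stabilizer arrows. -/
def stabilizerSpace : Set G.Arr := {g | G.src g = G.tgt g}

/-- The stabilizer of an object. -/
@[ext]
structure Stab (x : G.Obj) where
  arr : G.Arr
  src_eq : G.src arr = x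
  tgt_eq : G.tgt arr = x

instance (x : G.Obj) : Group (G.Stab x) where
  mul a b := ⟨G.mul a.arr b.arr (a.src_eq.trans b.tgt_eq.symm),
    (G.src_mul ..).trans b.src_eq, (G.tgt_mul ..).trans a.tgt_eq⟩
  one := ⟨G.unit x, G.src_unit x, G.tgt_unit x⟩
  inv a := ⟨G.inv a.arr, (G.src_inv _).trans a.tgt_eq, (G.tgt_inv _).trans a.src_eq⟩
  mul_assoc a b c := Stab.ext (G.mul_assoc a.arr b.arr c.arr _ _).symm
  one_mul a := Stab.ext (G.unit_mul' _)
  mul_one a := Stab.ext (G.mul_unit' _)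
  inv_mul_cancel a := Stab.ext ((G.inv_mul a.arr).trans (congrArg G.unit a.src_eq))

lemma continuousAt_mul {X : Type*} [TopologicalSpace X] {x : X} {a b : X → G.Arr}
    (ha : ContinuousAt a x) (hb : ContinuousAt b x) (h : ∀ y, G.src (a y) = G.tgt (b y)) :
    ContinuousAt (fun y => G.mul (a y) (b y) (h y)) x := by
  obtain ⟨U, hU, hxU, F, hF, hFe⟩ := G.smooth_mul ⟨(a x, b x), h x⟩
  have h1 : ContinuousAt F (a x, b x) := (hF.continuousOn).continuousAt (hU.mem_nhds hxU)
  have h2 : ContinuousAt (fun y => (a y, b y)) x := ha.prodMk hb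
  have h3 : ContinuousAt (fun y => F (a y, b y)) x :=
    ContinuousAt.comp (f := fun y => (a y, b y)) (g := F) h1 h2
  refine h3.congr ?_
  filter_upwards [h2.preimage_mem_nhds (hU.mem_nhds hxU)] with y hy
  exact hFe ⟨(a y, b y), h y⟩ hy

/-- The stabilizers of an orbifold groupoid are finite. -/
instance [hG : G.IsOrbifold] (x : G.Obj) : Finite (G.Stab x) := by
  have hK : IsCompact {g : G.Arr | G.src g = x ∧ G.tgt g = x} := by
    have := hG.proper.isCompact_preimage (isCompact_singleton (x := (x, x)))
    convert this using 1
    ext g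
    simp
  have hD : DiscreteTopology {g : G.Arr | G.src g = x ∧ G.tgt g = x} := by
    rw [discreteTopology_subtype_iff']
    rintro g ⟨hg, hg'⟩
    have hl := hG.etale g
    refine ⟨hl.localInverse.target, hl.localInverse.open_target, ?_⟩
    ext k
    constructor
    · rintro ⟨hk, hk1, hk2⟩
      have e1 := hl.localInverse_left_inv hk
      have e2 := hl.localInverse_left_inv hl.localInverse_mem_target
      rw [hk1] at e1
      rw [hg] at e2
      exact e1.symm.trans e2
    · rintro rfl
      exact ⟨hl.localInverse_mem_target, hg, hg'⟩
  have := isCompact_iff_compactSpace.1 hK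
  have : Finite {g : G.Arr | G.src g = x ∧ G.tgt g = x} := finite_of_compact_of_discrete
  exact Finite.of_injective
    (fun a : G.Stab x => (⟨a.arr, a.src_eq, a.tgt_eq⟩ : {g : G.Arr | G.src g = x ∧ G.tgt g = x}))
    fun a b h => Stab.ext (congrArg Subtype.val h)

variable [hG : G.IsEtale]

/-- The germ at `src g` of the local diffeomorphism of the space of objects induced by `g`:
a local inverse of `src` through `g`, followed by `tgt`. -/
def inducedGerm (g : G.Arr) : (𝓝 (G.src g)).Germ G.Obj :=
  ((fun y => G.tgt ((hG.etale g).localInverse y) : G.Obj → G.Obj) : (𝓝 (G.src g)).Germ G.Obj)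

/-- The space of ineffective stabilizers: the stabilizer arrows whose germ is trivial. -/
def ineffectiveSpace : Set G.Arr :=
  {g | g ∈ G.stabilizerSpace ∧ G.inducedGerm g = ((id : G.Obj → G.Obj) : (𝓝 (G.src g)).Germ G.Obj)}

/-- Purely ineffective groupoids. -/
def IsPurelyIneffective : Prop := G.ineffectiveSpace = G.stabilizerSpace

lemma mem_ineffectiveSpace_iff (g : G.Arr) :
    g ∈ G.ineffectiveSpace ↔ ∀ᶠ h in 𝓝 g, G.src h = G.tgt h := by
  have hl := hG.etale g
  have hsg : Filter.Tendsto G.src (𝓝 g) (𝓝 (G.src g)) :=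
    G.smooth_src.continuous.continuousAt
  have hcont : Filter.Tendsto hl.localInverse (𝓝 (G.src g)) (𝓝 g) := by
    have h1 : ContinuousAt hl.localInverse (G.src g) := hl.localInverse_contMDiffAt.continuousAt
    have h2 : hl.localInverse (G.src g) = g := hl.localInverse_left_inv hl.localInverse_mem_target
    unfold ContinuousAt at h1
    rwa [h2] at h1
  have hleft : ∀ᶠ h in 𝓝 g, hl.localInverse (G.src h) = h := hl.localInverse_eventuallyEq_left
  have hright : ∀ᶠ y in 𝓝 (G.src g), G.src (hl.localInverse y) = y :=
    hl.localInverse_eventuallyEq_right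
  have key : G.inducedGerm g = ((id : G.Obj → G.Obj) : (𝓝 (G.src g)).Germ G.Obj) ↔
      ∀ᶠ y in 𝓝 (G.src g), G.tgt (hl.localInverse y) = y := Filter.Germ.coe_eq
  constructor
  · rintro ⟨-, h⟩
    filter_upwards [hleft, hsg.eventually (key.1 h)] with k hk hk'
    rw [hk] at hk'
    exact hk'.symm
  · intro h
    refine ⟨h.self_of_nhds, key.2 ?_⟩
    filter_upwards [hright, hcont.eventually h] with y hy hy'
    rw [← hy', hy]

lemma unit_mem_ineffectiveSpace (x : G.Obj) : G.unit x ∈ G.ineffectiveSpace := by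
  rw [mem_ineffectiveSpace_iff]
  have hl := hG.etale (G.unit x)
  have h2 : ∀ᶠ h in 𝓝 (G.unit x), hl.localInverse (G.src h) = h :=
    hl.localInverse_eventuallyEq_left
  have hc : Filter.Tendsto (fun h => G.unit (G.src h)) (𝓝 (G.unit x)) (𝓝 (G.unit x)) := by
    have := (G.smooth_unit.continuous.comp G.smooth_src.continuous).continuousAt
      (x := G.unit x)
    unfold ContinuousAt at this
    simpa [G.src_unit, Function.comp_def] using this
  filter_upwards [h2, hc.eventually h2] with h hh hh'
  rw [G.src_unit, hh] at hh'
  conv_rhs => rw [hh', G.tgt_unit]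

/-- The group of ineffective stabilizers at `x`. -/
def ineffStab (x : G.Obj) : Subgroup (G.Stab x) where
  carrier := {a | a.arr ∈ G.ineffectiveSpace}
  one_mem' := G.unit_mem_ineffectiveSpace x
  inv_mem' := by
    intro a ha
    have h1 : ∀ᶠ k in 𝓝 a.arr, G.src k = G.tgt k := (G.mem_ineffectiveSpace_iff _).1 ha
    refine (G.mem_ineffectiveSpace_iff _).2 ?_
    have h2 : G.inv (a⁻¹).arr = a.arr := congrArg Stab.arr (inv_inv a)
    have hc : Filter.Tendsto G.inv (𝓝 (a⁻¹).arr) (𝓝 a.arr) := by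
      have := G.smooth_inv.continuous.continuousAt (x := (a⁻¹).arr)
      unfold ContinuousAt at this
      rwa [h2] at this
    filter_upwards [hc.eventually h1] with k hk
    rw [G.src_inv, G.tgt_inv] at hk
    exact hk.symm
  mul_mem' := by
    classical
    intro a b ha hb
    have ha' : ∀ᶠ k in 𝓝 a.arr, G.src k = G.tgt k := (G.mem_ineffectiveSpace_iff _).1 ha
    have hb' : ∀ᶠ k in 𝓝 b.arr, G.src k = G.tgt k := (G.mem_ineffectiveSpace_iff _).1 hb
    refine (G.mem_ineffectiveSpace_iff _).2 ?_
    have hl := hG.etale b.arr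
    have hxb : G.src b.arr = x := b.src_eq
    have hsab : G.src (a * b).arr = x := (a * b).src_eq
    have hσx : hl.localInverse x = b.arr := by
      have h0 := hl.localInverse_left_inv hl.localInverse_mem_target
      rwa [hxb] at h0
    have hcont : ContinuousAt hl.localInverse x := by
      have h0 := hl.localInverse_contMDiffAt.continuousAt
      rwa [hxb] at h0
    have hright : ∀ᶠ y in 𝓝 x, G.src (hl.localInverse y) = y := by
      have h0 : ∀ᶠ y in 𝓝 (G.src b.arr), G.src (hl.localInverse y) = y :=
        hl.localInverse_eventuallyEq_right
      rwa [hxb] at h0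
    have hsrc : Filter.Tendsto G.src (𝓝 (a * b).arr) (𝓝 x) := by
      have := G.smooth_src.continuous.continuousAt (x := (a * b).arr)
      unfold ContinuousAt at this
      rwa [hsab] at this
    have htσ : ∀ᶠ y in 𝓝 x, G.src (hl.localInverse y) = G.tgt (hl.localInverse y) := by
      unfold ContinuousAt at hcont
      rw [hσx] at hcont
      exact hcont.eventually hb'
    let r : G.Arr → G.Arr := fun k =>
      if G.src (hl.localInverse (G.src k)) = G.src k then G.inv (hl.localInverse (G.src k))
      else G.inv k
    have hr : ∀ k, G.src k = G.tgt (r k) := by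
      intro k
      by_cases h : G.src (hl.localInverse (G.src k)) = G.src k
      · simp only [r, if_pos h, G.tgt_inv, h]
      · simp only [r, if_neg h, G.tgt_inv]
    have hre : ∀ᶠ k in 𝓝 (a * b).arr, r k = G.inv (hl.localInverse (G.src k)) := by
      filter_upwards [hsrc.eventually hright] with k hk
      simp only [r, if_pos hk]
    have hrc : ContinuousAt r (a * b).arr := by
      have h1 : ContinuousAt (fun k => G.inv (hl.localInverse (G.src k))) (a * b).arr := by
        refine G.smooth_inv.continuous.continuousAt.comp (f := fun k => hl.localInverse (G.src k)) ?_
        refine ContinuousAt.comp (f := G.src) (g := hl.localInverse) ?_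
          G.smooth_src.continuous.continuousAt
        rwa [hsab]
      exact h1.congr (hre.mono fun _ h => h.symm)
    have hm := G.continuousAt_mul (continuousAt_id (x := (a * b).arr)) hrc hr
    have hval : G.mul (id (a * b).arr) (r (a * b).arr) (hr _) = a.arr := by
      have h1 : r (a * b).arr = (b⁻¹).arr := by
        rw [hre.self_of_nhds, hsab, hσx]; rfl
      refine (G.mul_congr rfl h1 _ ((a * b).src_eq.trans (b⁻¹).tgt_eq.symm)).trans ?_
      exact congrArg Stab.arr (mul_inv_cancel_right a b)
    unfold ContinuousAt at hm
    simp only [hval] at hm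
    filter_upwards [hm.eventually ha', hre, hsrc.eventually hright, hsrc.eventually htσ]
      with k h1 h2 h3 h4
    rw [G.src_mul, G.tgt_mul, h2, G.src_inv, ← h4, h3] at h1
    exact h1

end SmoothGroupoid

/-! ### Lie group actions on groupoids and semidirect products -/

/-- A (strict, smooth) right action of the group `K` on the smooth groupoid `G`. -/
structure SmoothGroupoid.RightAction (G : SmoothGroupoid.{u})
    {E : Type*} [NormedAddCommGroup E] [NormedSpace ℝ E] {H : Type*} [TopologicalSpace H]
    (I : ModelWithCorners ℝ E H) (K : Type*) [TopologicalSpace K] [ChartedSpace H K] [Group K] where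
  obj : G.Obj → K → G.Obj
  arr : G.Arr → K → G.Arr
  obj_one : ∀ x, obj x 1 = x
  obj_mul : ∀ x k l, obj x (k * l) = obj (obj x k) l
  arr_one : ∀ g, arr g 1 = g
  arr_mul : ∀ g k l, arr g (k * l) = arr (arr g k) l
  smooth_obj : ContMDiff (G.Obj.I.prod I) G.Obj.I ∞ (fun p : G.Obj × K => obj p.1 p.2)
  smooth_arr : ContMDiff (G.Arr.I.prod I) G.Arr.I ∞ (fun p : G.Arr × K => arr p.1 p.2)
  unit_act : ∀ x k, arr (G.unit x) k = G.unit (obj x k)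
  src_act : ∀ g k, G.src (arr g k) = obj (G.src g) k
  tgt_act : ∀ g k, G.tgt (arr g k) = obj (G.tgt g) k
  mul_act : ∀ g h (e : G.src g = G.tgt h) k, arr (G.mul g h e) k =
    G.mul (arr g k) (arr h k)
      ((src_act g k).trans ((congrArg (fun x => obj x k) e).trans (tgt_act h k).symm))

namespace SmoothGroupoid

section Actions

variable {G : SmoothGroupoid.{u}}
  {EK : Type*} [NormedAddCommGroup EK] [NormedSpace ℝ EK] {HK : Type*} [TopologicalSpace HK]
  {IK : ModelWithCorners ℝ EK HK}
  {K : Type*} [TopologicalSpace K] [ChartedSpace HK K] [Group K]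
  {EL : Type} [NormedAddCommGroup EL] [NormedSpace ℝ EL] [FiniteDimensional ℝ EL]
  {HL : Type} [TopologicalSpace HL]
  {IL : ModelWithCorners ℝ EL HL} [IL.Boundaryless]
  {L : Type u} [TopologicalSpace L] [ChartedSpace HL L] [Group L] [LieGroup IL ∞ L]
  [T2Space L] [SecondCountableTopology L]

/-- Inverses are preserved by an action. -/
lemma RightAction.inv_act (α : G.RightAction IK K) (g : G.Arr) (k : K) :
    α.arr (G.inv g) k = G.inv (α.arr g k) := by
  have e1 : G.src (α.arr (G.inv g) k) = G.tgt (α.arr g k) := by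
    rw [α.src_act, α.tgt_act, G.src_inv]
  have e2 : G.src (α.arr g k) = G.tgt (G.inv (α.arr g k)) := (G.tgt_inv _).symm
  have h1 : G.mul (α.arr (G.inv g) k) (α.arr g k) e1 = G.unit (α.obj (G.src g) k) := by
    rw [← α.mul_act _ _ (G.src_inv g), G.inv_mul, α.unit_act]
  have h2 := G.mul_assoc (α.arr (G.inv g) k) (α.arr g k) (G.inv (α.arr g k)) e1 e2
  rw [G.mul_congr rfl (G.mul_inv (α.arr g k)) _ (by rw [G.tgt_unit, e1]), G.mul_unit',
    G.mul_congr h1 rfl _ (by rw [G.src_unit, G.tgt_inv, α.src_act]), G.unit_mul'] at h2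
  exact h2

/-- The action of the first factor of a product group acting on `G`. -/
def RightAction.fst (β : G.RightAction (IK.prod IL) (K × L)) : G.RightAction IK K where
  obj x k := β.obj x (k, 1)
  arr g k := β.arr g (k, 1)
  obj_one := β.obj_one
  obj_mul x k l := by rw [← β.obj_mul]; simp
  arr_one := β.arr_one
  arr_mul x k l := by rw [← β.arr_mul]; simp
  smooth_obj := β.smooth_obj.comp
    (contMDiff_fst.prodMk (contMDiff_snd.prodMk contMDiff_const))
  smooth_arr := β.smooth_arr.comp
    (contMDiff_fst.prodMk (contMDiff_snd.prodMk contMDiff_const))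
  unit_act x k := β.unit_act x _
  src_act g k := β.src_act g _
  tgt_act g k := β.tgt_act g _
  mul_act g h e k := β.mul_act g h e _

/-- The action of the second factor of a product group acting on `G`. -/
def RightAction.snd (β : G.RightAction (IK.prod IL) (K × L)) : G.RightAction IL L where
  obj x l := β.obj x (1, l)
  arr g l := β.arr g (1, l)
  obj_one := β.obj_one
  obj_mul x k l := by rw [← β.obj_mul]; simp
  arr_one := β.arr_one
  arr_mul x k l := by rw [← β.arr_mul]; simp
  smooth_obj := β.smooth_obj.comp
    (contMDiff_fst.prodMk (contMDiff_const.prodMk contMDiff_snd))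
  smooth_arr := β.smooth_arr.comp
    (contMDiff_fst.prodMk (contMDiff_const.prodMk contMDiff_snd))
  unit_act x k := β.unit_act x _
  src_act g k := β.src_act g _
  tgt_act g k := β.tgt_act g _
  mul_act g h e k := β.mul_act g h e _

lemma RightAction.semidirect_aux (α : G.RightAction IK K) {g g' : G.Arr} {l : K}
    (e : α.obj (G.src g) l = G.tgt g') : G.src g = G.tgt (α.arr g' l⁻¹) := by
  rw [α.tgt_act, ← e, ← α.obj_mul, mul_inv_cancel, α.obj_one]

lemma RightAction.smooth_obj_const (α : G.RightAction IK K) (l : K) :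
    ContMDiff G.Obj.I G.Obj.I ∞ (fun x => α.obj x l) :=
  α.smooth_obj.comp (contMDiff_id.prodMk contMDiff_const)

lemma RightAction.surjective_mfderiv (α : G.RightAction IK K) (p : G.Arr × K) :
    Function.Surjective (mfderiv (G.Arr.I.prod IK) G.Obj.I
      (fun p : G.Arr × K => α.obj (G.src p.1) p.2) p) := by
  obtain ⟨g, l⟩ := p
  have hsm : ContMDiff (G.Arr.I.prod IK) G.Obj.I ∞
      (fun p : G.Arr × K => α.obj (G.src p.1) p.2) :=
    α.smooth_obj.comp ((G.smooth_src.comp contMDiff_fst).prodMk contMDiff_snd)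
  have hin : ContMDiff G.Arr.I (G.Arr.I.prod IK) ∞ (fun g' : G.Arr => (g', l)) :=
    contMDiff_id.prodMk contMDiff_const
  have h1 := mfderiv_comp g (hsm.mdifferentiable (by simp) (g, l))
    (hin.mdifferentiable (by simp) g)
  have h2 := mfderiv_comp g ((α.smooth_obj_const l).mdifferentiable (by simp) (G.src g))
    (G.smooth_src.mdifferentiable (by simp) g)
  have h3 : Function.Surjective
      (mfderiv G.Obj.I G.Obj.I (fun x => α.obj x l) (G.src g)) := by
    have hx : α.obj (α.obj (G.src g) l) l⁻¹ = G.src g := by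
      rw [← α.obj_mul, mul_inv_cancel, α.obj_one]
    have h4 := mfderiv_comp (I := G.Obj.I) (I' := G.Obj.I) (I'' := G.Obj.I)
      (g := fun x => α.obj x l) (f := fun x => α.obj x l⁻¹) (α.obj (G.src g) l)
      ((α.smooth_obj_const l).mdifferentiable (by simp) _)
      ((α.smooth_obj_const l⁻¹).mdifferentiable (by simp) _)
    have h5 : (fun x => α.obj x l) ∘ (fun x => α.obj x l⁻¹) = id := by
      funext x
      simp only [Function.comp, ← α.obj_mul, inv_mul_cancel, α.obj_one, id]
    rw [h5, mfderiv_id] at h4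
    rw [hx] at h4
    intro v
    refine ⟨mfderiv G.Obj.I G.Obj.I (fun x => α.obj x l⁻¹) (α.obj (G.src g) l) v, ?_⟩
    exact (congrArg (fun T => T v) h4).symm
  have h6 : (fun p : G.Arr × K => α.obj (G.src p.1) p.2) ∘ (fun g' : G.Arr => (g', l)) =
      (fun x => α.obj x l) ∘ G.src := rfl
  rw [h6, h2] at h1
  intro v
  obtain ⟨w, hw⟩ := h3 v
  obtain ⟨z, hz⟩ := G.submersion_src.2 g w
  refine ⟨mfderiv G.Arr.I (G.Arr.I.prod IK) (fun g' : G.Arr => (g', l)) g z, ?_⟩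
  have h7 := congrArg (fun T => T z) h1
  refine h7.symm.trans ?_
  rw [← hw, ← hz]
  rfl

/-- The semidirect product `G ⋊ L`. -/
def semidirect (α : G.RightAction IL L) : SmoothGroupoid.{u} where
  Obj := G.Obj
  Arr := G.Arr.prod (Mfd.ofLie IL L)
  src p := α.obj (G.src p.1) p.2
  tgt p := G.tgt p.1
  unit x := (G.unit x, 1)
  inv p := (α.arr (G.inv p.1) p.2, p.2⁻¹)
  mul p q e := (G.mul p.1 (α.arr q.1 p.2⁻¹) (α.semidirect_aux e), p.2 * q.2)
  src_unit x := by rw [α.obj_one, G.src_unit]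
  tgt_unit x := G.tgt_unit x
  src_inv p := by
    rw [α.src_act, ← α.obj_mul, mul_inv_cancel, α.obj_one, G.src_inv]
  tgt_inv p := by rw [α.tgt_act, G.tgt_inv]
  src_mul p q e := by
    rw [G.src_mul, α.src_act, ← α.obj_mul]
    congr 1
    group
  tgt_mul p q e := G.tgt_mul _ _ _
  mul_assoc p q r e e' := by
    refine Prod.ext ?_ (_root_.mul_assoc _ _ _).symm
    have h1 := α.mul_act q.1 (α.arr r.1 q.2⁻¹) (α.semidirect_aux e') p.2⁻¹
    have h2 : α.arr (α.arr r.1 q.2⁻¹) p.2⁻¹ = α.arr r.1 (p.2 * q.2)⁻¹ := by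
      rw [← α.arr_mul, mul_inv_rev]
    refine (G.mul_congr rfl h1 _ ?_).trans ?_
    · rw [← h1]; exact α.semidirect_aux (e.trans (G.tgt_mul _ _ _).symm)
    · rw [G.mul_assoc _ _ _ (α.semidirect_aux e)]
      exact G.mul_congr rfl h2 _ _
  mul_unit p := by
    refine Prod.ext ?_ (mul_one _)
    have h1 : α.arr (G.unit (α.obj (G.src p.1) p.2)) p.2⁻¹ = G.unit (G.src p.1) := by
      rw [α.unit_act, ← α.obj_mul, mul_inv_cancel, α.obj_one]
    exact (G.mul_congr rfl h1 _ (G.tgt_unit _).symm).trans (G.mul_unit _)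
  unit_mul p := by
    refine Prod.ext ?_ (one_mul _)
    have h1 : α.arr p.1 (1 : L)⁻¹ = p.1 := by rw [inv_one, α.arr_one]
    exact (G.mul_congr rfl h1 _ (G.src_unit _)).trans (G.unit_mul _)
  inv_mul p := by
    refine Prod.ext ?_ (inv_mul_cancel _)
    have h1 : α.arr p.1 (p.2⁻¹)⁻¹ = α.arr p.1 p.2 := by rw [inv_inv]
    refine (G.mul_congr rfl h1 _ ?_).trans ?_
    · rw [α.src_act, α.tgt_act, G.src_inv]
    · rw [← α.mul_act _ _ (G.src_inv _), G.inv_mul, α.unit_act]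
  mul_inv p := by
    refine Prod.ext ?_ (mul_inv_cancel _)
    have h1 : α.arr (α.arr (G.inv p.1) p.2) p.2⁻¹ = G.inv p.1 := by
      rw [← α.arr_mul, mul_inv_cancel, α.arr_one]
    exact (G.mul_congr rfl h1 _ (G.tgt_inv _).symm).trans (G.mul_inv _)
  smooth_src := α.smooth_obj.comp
    ((G.smooth_src.comp contMDiff_fst).prodMk contMDiff_snd)
  smooth_tgt := G.smooth_tgt.comp contMDiff_fst
  smooth_unit := G.smooth_unit.prodMk contMDiff_const
  smooth_inv := (α.smooth_arr.comp
    ((G.smooth_inv.comp contMDiff_fst).prodMk contMDiff_snd)).prodMk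
      ((contMDiff_inv IL ∞).comp contMDiff_snd)
  smooth_mul := by
    rintro ⟨⟨p, q⟩, e⟩
    obtain ⟨U, hU, hpU, F, hF, hFe⟩ :=
      G.smooth_mul ⟨(p.1, α.arr q.1 p.2⁻¹), α.semidirect_aux e⟩
    let Ψ : (G.Arr × L) × (G.Arr × L) → G.Arr × G.Arr := fun z => (z.1.1, α.arr z.2.1 z.1.2⁻¹)
    have hΨ : ContMDiff ((G.Arr.I.prod IL).prod (G.Arr.I.prod IL)) (G.Arr.I.prod G.Arr.I) ∞ Ψ :=
      (contMDiff_fst.comp contMDiff_fst).prodMk (α.smooth_arr.comp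
        ((contMDiff_fst.comp contMDiff_snd).prodMk
          ((contMDiff_inv IL ∞).comp (contMDiff_snd.comp contMDiff_fst))))
    have hm : ContMDiff ((G.Arr.I.prod IL).prod (G.Arr.I.prod IL)) IL ∞
        (fun z : (G.Arr × L) × (G.Arr × L) => z.1.2 * z.2.2) :=
      (contMDiff_snd.comp contMDiff_fst).mul (contMDiff_snd.comp contMDiff_snd)
    refine ⟨Ψ ⁻¹' U, hU.preimage hΨ.continuous, hpU, fun z => (F (Ψ z), z.1.2 * z.2.2), ?_, ?_⟩
    · exact (hF.comp hΨ.contMDiffOn (fun z hz => hz)).prodMk hm.contMDiffOn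
    · rintro ⟨⟨p', q'⟩, e'⟩ hz
      exact Prod.ext (hFe ⟨Ψ (p', q'), α.semidirect_aux e'⟩ hz) rfl
  submersion_src := ⟨α.smooth_obj.comp
    ((G.smooth_src.comp contMDiff_fst).prodMk contMDiff_snd), α.surjective_mfderiv⟩

/-- If `K × L` acts on `G`, then `K` acts on `G ⋊ L` by `(g, l) · k = (g · k, l)`. -/
def RightAction.onSemidirect (β : G.RightAction (IK.prod IL) (K × L)) :
    (semidirect β.snd).RightAction IK K where
  obj x k := β.obj x (k, 1)
  arr p k := (β.arr p.1 (k, 1), p.2)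
  obj_one := β.obj_one
  obj_mul := β.fst.obj_mul
  arr_one p := Prod.ext (β.arr_one p.1) rfl
  arr_mul p k l := Prod.ext (β.fst.arr_mul p.1 k l) rfl
  smooth_obj := β.fst.smooth_obj
  smooth_arr := (β.fst.smooth_arr.comp
    ((contMDiff_fst.comp contMDiff_fst).prodMk contMDiff_snd)).prodMk
      (contMDiff_snd.comp contMDiff_fst)
  unit_act x k := Prod.ext (β.unit_act x _) rfl
  src_act p k := by
    change β.obj (G.src (β.arr p.1 (k, 1))) (1, p.2) = β.obj (β.obj (G.src p.1) (1, p.2)) (k, 1)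
    rw [β.src_act, ← β.obj_mul, ← β.obj_mul]
    simp
  tgt_act p k := β.tgt_act p.1 _
  mul_act p q e k := by
    refine Prod.ext ?_ rfl
    have h1 : β.arr (β.arr q.1 (1, p.2⁻¹)) (k, 1) = β.arr (β.arr q.1 (k, 1)) (1, p.2⁻¹) := by
      rw [← β.arr_mul, ← β.arr_mul]
      simp
    exact (β.mul_act p.1 _ (β.snd.semidirect_aux e) (k, 1)).trans (G.mul_congr rfl h1 _ _)

end Actions

/-! ### Hilsum-Skandalis equivalences -/

/-- A right action of the groupoid `G` on the manifold `X`. -/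
structure RightSpace (G : SmoothGroupoid.{u}) (X : Mfd.{u}) where
  base : X → G.Obj
  act : (x : X) → (g : G.Arr) → base x = G.tgt g → X
  smooth_base : ContMDiff X.I G.Obj.I ∞ base
  smooth_act : SmoothOnSubset (X.I.prod G.Arr.I) X.I {p : X × G.Arr | base p.1 = G.tgt p.2}
    (fun p => act p.1.1 p.1.2 p.2)
  base_act : ∀ x g e, base (act x g e) = G.src g
  act_unit : ∀ x, act x (G.unit (base x)) (G.tgt_unit _).symm = x
  act_act : ∀ x g h (e : base x = G.tgt g) (e' : G.src g = G.tgt h),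
    act (act x g e) h ((base_act x g e).trans e') =
      act x (G.mul g h e') (e.trans (G.tgt_mul g h e').symm)

/-- A left action of the groupoid `G` on the manifold `X`. -/
structure LeftSpace (G : SmoothGroupoid.{u}) (X : Mfd.{u}) where
  base : X → G.Obj
  act : (g : G.Arr) → (x : X) → G.src g = base x → X
  smooth_base : ContMDiff X.I G.Obj.I ∞ base
  smooth_act : SmoothOnSubset (G.Arr.I.prod X.I) X.I {p : G.Arr × X | G.src p.1 = base p.2}
    (fun p => act p.1.1 p.1.2 p.2)
  base_act : ∀ g x e, base (act g x e) = G.tgt g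
  unit_act : ∀ x, act (G.unit (base x)) x (G.src_unit _) = x
  act_act : ∀ g h x (e : G.src g = G.tgt h) (e' : G.src h = base x),
    act g (act h x e') (e.trans (base_act h x e').symm) =
      act (G.mul g h e) x ((G.src_mul g h e).trans e')

/-- `p : X → B` is a principal right `G`-bundle: it is an invariant surjective submersion and
`(x, g) ↦ (x, x g)` is a diffeomorphism from `X ×_{G₀} G₁` onto `X ×_B X`. -/
def RightSpace.IsPrincipal {G : SmoothGroupoid.{u}} {X : Mfd.{u}} (a : G.RightSpace X)
    {B : Mfd.{u}} (p : X → B) : Prop :=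
  Function.Surjective p ∧ IsSmoothSubmersion X.I B.I p ∧
  ∃ hinv : ∀ x g e, p (a.act x g e) = p x,
    IsDiffeoOfSubsets (X.I.prod G.Arr.I) (X.I.prod X.I)
      (A := {q : X × G.Arr | a.base q.1 = G.tgt q.2}) (B := {q : X × X | p q.1 = p q.2})
      (fun q => ⟨(q.1.1, a.act q.1.1 q.1.2 q.2), (hinv _ _ _).symm⟩)

/-- `p : X → B` is a principal left `G`-bundle: it is an invariant surjective submersion and
`(g, x) ↦ (g x, x)` is a diffeomorphism from `G₁ ×_{G₀} X` onto `X ×_B X`. -/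
def LeftSpace.IsPrincipal {G : SmoothGroupoid.{u}} {X : Mfd.{u}} (a : G.LeftSpace X)
    {B : Mfd.{u}} (p : X → B) : Prop :=
  Function.Surjective p ∧ IsSmoothSubmersion X.I B.I p ∧
  ∃ hinv : ∀ g x e, p (a.act g x e) = p x,
    IsDiffeoOfSubsets (G.Arr.I.prod X.I) (X.I.prod X.I)
      (A := {q : G.Arr × X | G.src q.1 = a.base q.2}) (B := {q : X × X | p q.1 = p q.2})
      (fun q => ⟨(a.act q.1.1 q.1.2 q.2, q.1.2), hinv _ _ _⟩)

/-- A Hilsum-Skandalis morphism from `G` to `H`. -/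
structure HSMorphism (G H : SmoothGroupoid.{u}) where
  P : Mfd.{u}
  left : G.LeftSpace P
  right : H.RightSpace P
  src_invariant : ∀ p h e, left.base (right.act p h e) = left.base p
  tgt_invariant : ∀ g p e, right.base (left.act g p e) = right.base p
  act_comm : ∀ g p h (e : G.src g = left.base p) (e' : right.base p = H.tgt h),
    right.act (left.act g p e) h ((tgt_invariant g p e).trans e') =
      left.act g (right.act p h e') (e.trans (src_invariant p h e').symm)
  principal : right.IsPrincipal left.base

/-- A Hilsum-Skandalis morphism is an equivalence if it is principal on both sides. -/
def HSMorphism.IsEquivalence {G H : SmoothGroupoid.{u}} (f : G.HSMorphism H) : Prop :=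
  f.left.IsPrincipal f.right.base

section Equivariance

variable {EK : Type*} [NormedAddCommGroup EK] [NormedSpace ℝ EK] {HK : Type*} [TopologicalSpace HK]
  {IK : ModelWithCorners ℝ EK HK}
  {K : Type*} [TopologicalSpace K] [ChartedSpace HK K] [Group K]

/-- A `K`-equivariant structure on a Hilsum-Skandalis morphism between groupoids with right
`K`-actions: a smooth right action of `K` on the bibundle, compatible with everything. -/
structure HSMorphism.Equivariance {G H : SmoothGroupoid.{u}} (f : G.HSMorphism H)
    (α : G.RightAction IK K) (β : H.RightAction IK K) where
  act : f.P → K → f.P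
  act_one : ∀ p, act p 1 = p
  act_mul : ∀ p k l, act p (k * l) = act (act p k) l
  smooth_act : ContMDiff (f.P.I.prod IK) f.P.I ∞ (fun q : f.P × K => act q.1 q.2)
  left_base : ∀ p k, f.left.base (act p k) = α.obj (f.left.base p) k
  right_base : ∀ p k, f.right.base (act p k) = β.obj (f.right.base p) k
  left_act : ∀ g p (e : G.src g = f.left.base p) k, act (f.left.act g p e) k =
    f.left.act (α.arr g k) (act p k) (by rw [α.src_act, left_base, e])
  right_act : ∀ p h (e : f.right.base p = H.tgt h) k, act (f.right.act p h e) k =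
    f.right.act (act p k) (β.arr h k) (by rw [β.tgt_act, right_base, e])

/-- The groupoids `G` and `H` with right `K`-actions are `K`-equivariantly equivalent. -/
def EquivariantlyEquivalent {G H : SmoothGroupoid.{u}}
    (α : G.RightAction IK K) (β : H.RightAction IK K) : Prop :=
  ∃ f : G.HSMorphism H, f.IsEquivalence ∧ Nonempty (f.Equivariance α β)

/-- A `(G, K)`-equivariant isomorphism of local systems of groups over the objects of `G`, from
the constant one with fibre `A` to that of ineffective stabilizers. Here `K` acts on `G` on the
right through `α` and on the group `A` on the right through `ρ`, and an arrow `g : x → y` acts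
on the right by `(y, a) ↦ (x, a)` and, by conjugation, `h ↦ g⁻¹ h g`. -/
structure StabilizerTrivialization {G : SmoothGroupoid.{u}} [G.IsEtale]
    (α : G.RightAction IK K) (A : Type w) [Group A] (ρ : A → K → A) where
  toFun : G.Obj × Disc A → G.Arr
  src_toFun : ∀ x a, G.src (toFun (x, a)) = x
  tgt_toFun : ∀ x a, G.tgt (toFun (x, a)) = x
  /- a diffeomorphism onto the (open) space of ineffective stabilizers -/
  localDiffeo : IsLocalDiffeomorph (G.Obj.I.prod Disc.model) G.Arr.I ∞ toFun
  injective : Function.Injective toFun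
  range_eq : Set.range toFun = G.ineffectiveSpace
  map_mul : ∀ x (a b : Disc A), toFun (x, a * b) =
    G.mul (toFun (x, a)) (toFun (x, b)) ((src_toFun x a).trans (tgt_toFun x b).symm)
  conj : ∀ (g : G.Arr) a, toFun (G.src g, a) =
    G.mul (G.mul (G.inv g) (toFun (G.tgt g, a)) ((G.src_inv g).trans (tgt_toFun _ a).symm)) g
      ((G.src_mul _ _ _).trans (src_toFun _ a))
  equivariant : ∀ x (a : A) k, α.arr (toFun (x, a)) k = toFun (α.obj x k, ρ a k)

end Equivariance

end SmoothGroupoid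

end

/-!
A frame at an object is an isomorphism from `T` onto its stabilizer. For a purely ineffective `G`
the local sections of the source map through the elements of a stabilizer are locally closed under
composition, and properness makes them exhaust the neighbouring stabilizers. So the isomorphism
type of the stabilizers is locally constant, hence constant if `G` is connected, and the frames form
a manifold étale over `G₀` on which `Aut T` acts by precomposition, simply transitively on fibres.

`G'` is the action groupoid of `G` acting on frames by conjugation, with `K` acting by translation.
Dividing out `Aut T` gives back `G`, through the bibundle of the arrows of `G'`. An arrow fixing a
frame `φ` is `φ z` for some `z` commuting with all of `T`, so `(φ, z) ↦ φ z` trivializes the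
stabilizers of `G'` by the center of `T`.
-/

noncomputable section

section LocalDiffeomorphisms

variable {𝕜 : Type*} [NontriviallyNormedField 𝕜] {E₁ E₂ E₃ : Type*}
  [NormedAddCommGroup E₁] [NormedSpace 𝕜 E₁] [NormedAddCommGroup E₂] [NormedSpace 𝕜 E₂]
  [NormedAddCommGroup E₃] [NormedSpace 𝕜 E₃]
  {H₁ H₂ H₃ : Type*} [TopologicalSpace H₁] [TopologicalSpace H₂] [TopologicalSpace H₃]
  {I₁ : ModelWithCorners 𝕜 E₁ H₁} {I₂ : ModelWithCorners 𝕜 E₂ H₂} {I₃ : ModelWithCorners 𝕜 E₃ H₃}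
  {M N B : Type*} [TopologicalSpace M] [ChartedSpace H₁ M] [TopologicalSpace N]
  [ChartedSpace H₂ N] [TopologicalSpace B] [ChartedSpace H₃ B] {n : WithTop ℕ∞}

lemma contMDiffAt_of_isLocalDiffeomorphAt_comp {p : N → B} {f : M → N} {x : M}
    (hp : IsLocalDiffeomorphAt I₂ I₃ n p (f x)) (hf : ContinuousAt f x)
    (hpf : ContMDiffAt I₁ I₃ n (fun y => p (f y)) x) : ContMDiffAt I₁ I₂ n f x := by
  have hsmooth : ContMDiffAt I₁ I₂ n (fun y => hp.localInverse (p (f y))) x :=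
    ContMDiffAt.comp x (g := hp.localInverse) hp.localInverse_contMDiffAt hpf
  refine hsmooth.congr_of_eventuallyEq ?_
  filter_upwards [hf.eventually hp.localInverse_eventuallyEq_left] with y hy using hy.symm

lemma contMDiff_of_isLocalDiffeomorph_comp {p : N → B} {f : M → N}
    (hp : IsLocalDiffeomorph I₂ I₃ n p) (hf : Continuous f)
    (hpf : ContMDiff I₁ I₃ n (fun y => p (f y))) : ContMDiff I₁ I₂ n f :=
  fun x => contMDiffAt_of_isLocalDiffeomorphAt_comp (hp _) hf.continuousAt (hpf x)

lemma isLocalDiffeomorph_of_isLocalHomeomorph {f : M → N} (hf : IsLocalHomeomorph f)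
    (hsmooth : ContMDiff I₁ I₂ n f)
    (hinv : ∀ x, ContMDiffOn I₂ I₁ n (hf.localInverseAt x) (hf.localInverseAt x).source) :
    IsLocalDiffeomorph I₁ I₂ n f := fun x =>
  ⟨{ toPartialEquiv := (hf.localInverseAt x).symm.toPartialEquiv
     open_source := (hf.localInverseAt x).open_target
     open_target := (hf.localInverseAt x).open_source
     contMDiffOn_toFun := by
       change ContMDiffOn I₁ I₂ n (hf.localInverseAt x).symm _
       rw [hf.localInverseAt_symm]
       exact hsmooth.contMDiffOn
     contMDiffOn_invFun := hinv x },
    hf.self_mem_localInverseAt_target, fun y _ => (congrFun (hf.localInverseAt_symm x) y).symm⟩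

lemma isLocalDiffeomorph_comp {p : N → B} {f : M → N} (hp : IsLocalDiffeomorph I₂ I₃ n p)
    (hf : IsLocalDiffeomorph I₁ I₂ n f) : IsLocalDiffeomorph I₁ I₃ n (fun x => p (f x)) :=
  fun x => IsLocalDiffeomorphAt.comp I₃ B (hf x) (hp (f x))

lemma isLocalDiffeomorph_of_comp {p : N → B} {f : M → N}
    (hp : IsLocalDiffeomorph I₂ I₃ n p) (hf : Continuous f)
    (hpf : IsLocalDiffeomorph I₁ I₃ n (fun y => p (f y))) : IsLocalDiffeomorph I₁ I₂ n f := by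
  have hhomeo : IsLocalHomeomorph f :=
    IsLocalHomeomorph.of_comp (g := p) hpf.isLocalHomeomorph hp.isLocalHomeomorph hf
  refine isLocalDiffeomorph_of_isLocalHomeomorph hhomeo
    (contMDiff_of_isLocalDiffeomorph_comp hp hf hpf.contMDiff) fun x y hy => ?_
  refine (contMDiffAt_of_isLocalDiffeomorphAt_comp (hpf _)
    ((hhomeo.localInverseAt x).continuousAt hy)
    ((hp.contMDiff y).congr_of_eventuallyEq ?_)).contMDiffWithinAt
  filter_upwards [(hhomeo.localInverseAt x).open_source.mem_nhds hy] with z hz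
  rw [hhomeo.apply_localInverseAt_of_mem hz]

lemma isLocalDiffeomorph_fst_of_discrete [DiscreteTopology N] :
    IsLocalDiffeomorph (I₁.prod I₂) I₁ n (Prod.fst : M × N → M) := fun ⟨_, a⟩ =>
  ⟨{ toFun := Prod.fst
     invFun := fun x => (x, a)
     source := Set.univ ×ˢ {a}
     target := Set.univ
     map_source' := fun _ _ => Set.mem_univ _
     map_target' := fun _ _ => ⟨Set.mem_univ _, rfl⟩
     left_inv' := fun _ hy => Prod.ext rfl hy.2.symm
     right_inv' := fun _ _ => rfl
     open_source := isOpen_univ.prod (isOpen_discrete _)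
     open_target := isOpen_univ
     contMDiffOn_toFun := contMDiff_fst.contMDiffOn
     contMDiffOn_invFun := (contMDiff_id.prodMk contMDiff_const).contMDiffOn },
    ⟨Set.mem_univ _, rfl⟩, fun _ _ => rfl⟩

end LocalDiffeomorphisms

section SmoothOnSubset

variable {E₁ E₂ E₃ : Type*} [NormedAddCommGroup E₁] [NormedSpace ℝ E₁]
  [NormedAddCommGroup E₂] [NormedSpace ℝ E₂] [NormedAddCommGroup E₃] [NormedSpace ℝ E₃]
  {H₁ H₂ H₃ : Type*} [TopologicalSpace H₁] [TopologicalSpace H₂] [TopologicalSpace H₃]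
  {I₁ : ModelWithCorners ℝ E₁ H₁} {I₂ : ModelWithCorners ℝ E₂ H₂} {I₃ : ModelWithCorners ℝ E₃ H₃}
  {M N B : Type*} [TopologicalSpace M] [ChartedSpace H₁ M] [TopologicalSpace N]
  [ChartedSpace H₂ N] [TopologicalSpace B] [ChartedSpace H₃ B]

lemma IsSmoothSubmersion.of_isLocalDiffeomorph {f : M → N} (hf : IsLocalDiffeomorph I₁ I₂ ∞ f) :
    IsSmoothSubmersion I₁ I₂ f := by
  refine ⟨hf.contMDiff, fun x => ?_⟩
  rw [← hf.mfderivToContinuousLinearEquiv_coe (by simp) x]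
  exact (hf.mfderivToContinuousLinearEquiv (by simp) x).surjective

namespace SmoothOnSubset

variable {A : Set M}

lemma continuous {f : A → N} (hf : SmoothOnSubset I₁ I₂ A f) : Continuous f := by
  refine continuous_iff_continuousAt.2 fun x => ?_
  obtain ⟨U, hU, hxU, F, hF, hFf⟩ := hf x
  have hFx : ContinuousAt (fun y : A => F y) x :=
    (hF.continuousOn.continuousAt (hU.mem_nhds hxU)).comp continuousAt_subtype_val
  refine hFx.congr ?_
  filter_upwards [continuousAt_subtype_val.preimage_mem_nhds (hU.mem_nhds hxU)] with y hy
  exact hFf y hy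

lemma of_contMDiff {f : A → N} {F : M → N} (hF : ContMDiff I₁ I₂ ∞ F) (h : ∀ a : A, F a = f a) :
    SmoothOnSubset I₁ I₂ A f :=
  fun _ => ⟨Set.univ, isOpen_univ, trivial, F, hF.contMDiffOn, fun y _ => h y⟩

lemma of_isLocalDiffeomorph {p : N → B} (hp : IsLocalDiffeomorph I₂ I₃ ∞ p) {f : A → N}
    (hf : Continuous f) {F : M → B} (hF : ContMDiff I₁ I₃ ∞ F) (h : ∀ a : A, F a = p (f a)) :
    SmoothOnSubset I₁ I₂ A f := by
  intro x
  have hpx := hp (f x)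
  obtain ⟨W, hW, hWf⟩ := isOpen_induced_iff.1 (hpx.localInverse.open_target.preimage hf)
  have mem_W (y : A) : (y : M) ∈ W ↔ f y ∈ hpx.localInverse.target := Set.ext_iff.1 hWf y
  refine ⟨W ∩ F ⁻¹' hpx.localInverse.source,
    hW.inter (hpx.localInverse_open_source.preimage hF.continuous),
    ⟨(mem_W x).2 hpx.localInverse_mem_target, ?_⟩, fun y => hpx.localInverse (F y),
    hpx.localInverse_contMDiffOn.comp hF.contMDiffOn fun y hy => hy.2, fun y hy => ?_⟩
  · rw [Set.mem_preimage, h]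
    exact hpx.localInverse_mem_source
  · exact (congrArg hpx.localInverse (h y)).trans
      (hpx.localInverse_left_inv ((mem_W y).1 hy.1))

lemma prodMk {f : A → N} {g : A → B} (hf : SmoothOnSubset I₁ I₂ A f)
    (hg : SmoothOnSubset I₁ I₃ A g) :
    SmoothOnSubset I₁ (I₂.prod I₃) A (fun a => (f a, g a)) := by
  intro x
  obtain ⟨U, hU, hxU, F, hF, hFf⟩ := hf x
  obtain ⟨V, hV, hxV, F', hF', hFg⟩ := hg x
  exact ⟨U ∩ V, hU.inter hV, ⟨hxU, hxV⟩, fun y => (F y, F' y),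
    (hF.mono Set.inter_subset_left).prodMk (hF'.mono Set.inter_subset_right),
    fun y hy => Prod.ext (hFf y hy.1) (hFg y hy.2)⟩

lemma of_discrete [DiscreteTopology N] {f : A → N} (hf : Continuous f) :
    SmoothOnSubset I₁ I₂ A f := by
  intro x
  obtain ⟨W, hW, hWf⟩ := isOpen_induced_iff.1 ((isOpen_discrete {f x}).preimage hf)
  have mem_W (y : A) : (y : M) ∈ W ↔ f y = f x := Set.ext_iff.1 hWf y
  exact ⟨W, hW, (mem_W x).2 rfl, fun _ => f x, contMDiff_const.contMDiffOn,
    fun y hy => ((mem_W y).1 hy).symm⟩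

end SmoothOnSubset

end SmoothOnSubset

section EtaleManifold

variable {H M X : Type*} [TopologicalSpace H] [TopologicalSpace M] [ChartedSpace H M]
  [TopologicalSpace X] {f : X → M}

/-- The charted space structure that a local homeomorphism `f : X → M` pulls back from `M`: the
chart at `x` is the chart of `M` at `f x` precomposed with a local restriction of `f`. -/
@[reducible]
def etaleChartedSpace (H : Type*) [TopologicalSpace H] [ChartedSpace H M]
    (hf : IsLocalHomeomorph f) : ChartedSpace H X where
  atlas := {e | ∃ x : X, e = (hf.localInverseAt x).symm.trans (chartAt H (f x))}
  chartAt x := (hf.localInverseAt x).symm.trans (chartAt H (f x))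
  mem_chart_source x := by
    rw [OpenPartialHomeomorph.trans_source, hf.localInverseAt_symm]
    exact ⟨hf.self_mem_localInverseAt_target, mem_chart_source H (f x)⟩
  chart_mem_atlas x := ⟨x, rfl⟩

lemma hasGroupoid_etale (hf : IsLocalHomeomorph f) (𝒢 : StructureGroupoid H)
    [HasGroupoid M 𝒢] [ClosedUnderRestriction 𝒢] :
    letI := etaleChartedSpace H hf
    HasGroupoid X 𝒢 := by
  let := etaleChartedSpace H hf
  refine ⟨?_⟩
  rintro _ _ ⟨x, rfl⟩ ⟨y, rfl⟩
  set φ := hf.localInverseAt x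
  set ψ := hf.localInverseAt y
  set c := chartAt H (f x)
  set d := chartAt H (f y)
  set τ := (φ.symm.trans c).symm.trans (ψ.symm.trans d)
  have hτ (z : H) (hz : z ∈ τ.source) : ψ.symm (φ (c.symm z)) = c.symm z := by
    rw [hf.localInverseAt_symm]
    refine hf.apply_localInverseAt_of_mem ?_
    simp only [τ, OpenPartialHomeomorph.trans_source, OpenPartialHomeomorph.symm_source,
      OpenPartialHomeomorph.trans_target] at hz
    exact hz.1.2
  have hsub : τ.source ⊆ (c.symm.trans d).source := fun z hz => by
    have hcz := hτ z hz
    simp only [τ, OpenPartialHomeomorph.trans_source, OpenPartialHomeomorph.symm_source,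
      OpenPartialHomeomorph.trans_target, OpenPartialHomeomorph.coe_trans_symm,
      OpenPartialHomeomorph.symm_symm, Set.mem_inter_iff, Set.mem_preimage,
      Function.comp_apply] at hz ⊢
    exact ⟨hz.1.1, hcz ▸ hz.2.2⟩
  refine 𝒢.mem_of_eqOnSource (closedUnderRestriction' (𝒢.compatible (chart_mem_atlas H (f x))
    (chart_mem_atlas H (f y))) τ.open_source) ⟨?_, fun z hz => congrArg d (hτ z hz)⟩
  exact ((OpenPartialHomeomorph.restr_source' _ _ τ.open_source).trans
    (Set.inter_eq_right.2 hsub)).symm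

variable {𝕜 : Type*} [NontriviallyNormedField 𝕜] {E E' : Type*} [NormedAddCommGroup E]
  [NormedSpace 𝕜 E] {I : ModelWithCorners 𝕜 E H} [NormedAddCommGroup E'] [NormedSpace 𝕜 E']
  {H' : Type*} [TopologicalSpace H'] {I' : ModelWithCorners 𝕜 E' H'} {N : Type*}
  [TopologicalSpace N] [ChartedSpace H' N] {n : WithTop ℕ∞}

lemma contMDiffAt_etale_iff (hf : IsLocalHomeomorph f) {g : N → X} {y : N} :
    letI := etaleChartedSpace H hf
    ContMDiffAt I' I n g y ↔ ContinuousAt g y ∧ ContMDiffAt I' I n (fun z => f (g z)) y := by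
  let := etaleChartedSpace H hf
  have hchart : extChartAt I (g y) ∘ g = extChartAt I (f (g y)) ∘ fun z => f (g z) := by
    funext z
    exact congrArg (fun x => I (chartAt H (f (g y)) x))
      (congrFun (hf.localInverseAt_symm (g y)) (g z))
  rw [contMDiffAt_iff_target, contMDiffAt_iff_target (f := fun z => f (g z)), hchart]
  exact ⟨fun h => ⟨h.1, hf.continuous.continuousAt.comp h.1, h.2⟩, fun h => ⟨h.1, h.2.2⟩⟩

lemma isLocalDiffeomorph_etale (hf : IsLocalHomeomorph f) :
    letI := etaleChartedSpace H hf
    IsLocalDiffeomorph I I n f := by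
  let := etaleChartedSpace H hf
  refine isLocalDiffeomorph_of_isLocalHomeomorph hf
    (fun x => ((contMDiffAt_etale_iff hf (g := id)).1 contMDiffAt_id).2)
    fun x y hy => ContMDiffAt.contMDiffWithinAt ?_
  refine (contMDiffAt_etale_iff hf).2 ⟨(hf.localInverseAt x).continuousAt hy,
    contMDiffAt_id.congr_of_eventuallyEq ?_⟩
  filter_upwards [(hf.localInverseAt x).open_source.mem_nhds hy] with z hz
  exact hf.apply_localInverseAt_of_mem hz

/-- A Hausdorff, second countable space étale over a manifold, as a manifold. -/
def Mfd.etale {M : Mfd.{u}} {X : Type v} [TopologicalSpace X] [T2Space X]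
    [SecondCountableTopology X] {f : X → M} (hf : IsLocalHomeomorph f) : Mfd.{v} :=
  letI := etaleChartedSpace M.H hf
  haveI := hasGroupoid_etale hf (contDiffGroupoid ∞ M.I)
  haveI : IsManifold M.I ∞ X := IsManifold.mk' M.I ∞ X
  { E := M.E, H := M.H, I := M.I, carrier := X }

end EtaleManifold

section LocalHomeomorphisms

variable {X Y B : Type*} [TopologicalSpace X] [TopologicalSpace Y]

lemma isLocalHomeomorph_of_isLocallyInjective {f : X → Y} (hf : Continuous f)
    (hopen : IsOpenMap f) (hinj : IsLocallyInjective f) : IsLocalHomeomorph f := by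
  refine isLocalHomeomorph_iff_isOpenEmbedding_restrict.2 fun x => ?_
  obtain ⟨U, hU, hxU, hUf⟩ := hinj x
  exact ⟨U, hU.mem_nhds hxU, .of_continuous_injective_isOpenMap
    (hf.comp continuous_subtype_val) hUf.injective (hopen.domRestrict hU)⟩

lemma isLocallyInjective_pullback_snd {f : X → B} {g : Y → B} (hf : IsLocallyInjective f) :
    IsLocallyInjective (Function.Pullback.snd : f.Pullback g → Y) := by
  rintro ⟨⟨x, y⟩, hxy⟩
  obtain ⟨U, hU, hxU, hUf⟩ := hf x
  refine ⟨{p | p.fst ∈ U}, hU.preimage (continuous_fst.comp continuous_subtype_val), hxU, ?_⟩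
  rintro ⟨⟨a, b⟩, hab⟩ ha ⟨⟨a', b'⟩, hab'⟩ ha' (rfl : b = b')
  exact Subtype.ext (Prod.ext (hUf ha ha' (hab.trans hab'.symm)) rfl)

variable [TopologicalSpace B]

lemma isOpenMap_pullback_snd {f : X → B} {g : Y → B} (hf : IsOpenMap f) (hg : Continuous g) :
    IsOpenMap (Function.Pullback.snd : f.Pullback g → Y) := by
  refine isOpenMap_iff_nhds_le.2 fun ⟨⟨x, y⟩, hxy⟩ s hs => ?_
  obtain ⟨W, hW, hWs⟩ := (mem_nhds_induced Subtype.val _ _).1 hs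
  obtain ⟨U, hU, V, hV, hUV⟩ := mem_nhds_prod_iff.1 hW
  have hfU : f '' U ∈ 𝓝 (g y) := by
    rw [← show f x = g y from hxy]
    exact hf.image_mem_nhds hU
  filter_upwards [hg.continuousAt hfU, hV] with z ⟨x', hx', hx'z⟩ hz
  exact hWs (show (⟨(x', z), hx'z⟩ : f.Pullback g) ∈ Subtype.val ⁻¹' W from hUV ⟨hx', hz⟩)

lemma isLocalHomeomorph_pullback_snd {f : X → B} {g : Y → B} (hf : IsLocalHomeomorph f)
    (hg : Continuous g) : IsLocalHomeomorph (Function.Pullback.snd : f.Pullback g → Y) :=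
  isLocalHomeomorph_of_isLocallyInjective (continuous_snd.comp continuous_subtype_val)
    (isOpenMap_pullback_snd hf.isOpenMap hg)
    (isLocallyInjective_pullback_snd hf.isLocallyInjective)

end LocalHomeomorphisms

namespace SmoothGroupoid

variable (G : SmoothGroupoid.{u})

open Classical in
/-- The composite of two arrows, with junk value `g` if they are not composable. -/
def comp (g h : G.Arr) : G.Arr := if e : G.src g = G.tgt h then G.mul g h e else g

variable {G} {g h k : G.Arr}

lemma mul_eq_comp (e : G.src g = G.tgt h) : G.mul g h e = G.comp g h := by
  rw [comp, dif_pos e]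

lemma src_comp (e : G.src g = G.tgt h) : G.src (G.comp g h) = G.src h := by
  rw [← mul_eq_comp e, G.src_mul]

lemma tgt_comp (e : G.src g = G.tgt h) : G.tgt (G.comp g h) = G.tgt g := by
  rw [← mul_eq_comp e, G.tgt_mul]

lemma comp_assoc (e : G.src g = G.tgt h) (e' : G.src h = G.tgt k) :
    G.comp (G.comp g h) k = G.comp g (G.comp h k) := by
  have hassoc := G.mul_assoc g h k e e'
  simp only [mul_eq_comp] at hassoc
  exact hassoc.symm

lemma comp_unit {x : G.Obj} (e : G.src g = x) : G.comp g (G.unit x) = g := by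
  rw [← mul_eq_comp (e.trans (G.tgt_unit x).symm), G.mul_unit']

lemma unit_comp {x : G.Obj} (e : x = G.tgt g) : G.comp (G.unit x) g = g := by
  rw [← mul_eq_comp ((G.src_unit x).trans e), G.unit_mul']

lemma inv_comp (g : G.Arr) : G.comp (G.inv g) g = G.unit (G.src g) := by
  rw [← mul_eq_comp (G.src_inv g), G.inv_mul]

lemma comp_inv (g : G.Arr) : G.comp g (G.inv g) = G.unit (G.tgt g) := by
  rw [← mul_eq_comp (G.tgt_inv g).symm, G.mul_inv]

lemma inv_comp_cancel_left (e : G.src g = G.tgt h) : G.comp (G.inv g) (G.comp g h) = h := by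
  rw [← comp_assoc (G.src_inv g) e, inv_comp, unit_comp e]

lemma comp_inv_cancel_left (e : G.tgt g = G.tgt h) : G.comp g (G.comp (G.inv g) h) = h := by
  rw [← comp_assoc (G.tgt_inv g).symm ((G.src_inv g).trans e), comp_inv, unit_comp e]

lemma comp_inv_cancel_right (e : G.src g = G.tgt h) : G.comp (G.comp g h) (G.inv h) = g := by
  rw [comp_assoc e (G.tgt_inv h).symm, comp_inv, comp_unit e]

lemma inv_comp_cancel_right (e : G.src g = G.src h) : G.comp (G.comp g (G.inv h)) h = g := by
  rw [comp_assoc (e.trans (G.tgt_inv h).symm) (G.src_inv h), inv_comp, comp_unit e]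

lemma comp_right_cancel (e : G.src g = G.tgt k) (e' : G.src h = G.tgt k)
    (H : G.comp g k = G.comp h k) : g = h := by
  rw [← comp_inv_cancel_right e, H, comp_inv_cancel_right e']

lemma inv_inv (g : G.Arr) : G.inv (G.inv g) = g := by
  refine comp_right_cancel (k := G.inv g) (G.src_inv _) (G.tgt_inv _).symm ?_
  rw [inv_comp, comp_inv, G.src_inv]

lemma inv_comp_rev (e : G.src g = G.tgt h) :
    G.inv (G.comp g h) = G.comp (G.inv h) (G.inv g) := by
  have hinv : G.src (G.inv h) = G.tgt (G.inv g) := by rw [G.src_inv, G.tgt_inv, e]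
  refine comp_right_cancel (k := G.comp g h) (G.src_inv _)
    (by rw [src_comp hinv, G.src_inv, tgt_comp e]) ?_
  rw [inv_comp, src_comp e, comp_assoc hinv (by rw [G.src_inv, tgt_comp e]),
    inv_comp_cancel_left e, inv_comp]

lemma inv_unit (x : G.Obj) : G.inv (G.unit x) = G.unit x := by
  have hcomp := comp_inv (G.unit x)
  rwa [unit_comp (by rw [G.tgt_inv, G.src_unit]), G.tgt_unit] at hcomp

lemma continuousOn_comp :
    ContinuousOn (fun p : G.Arr × G.Arr => G.comp p.1 p.2) {p | G.src p.1 = G.tgt p.2} := by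
  rw [continuousOn_iff_continuous_domRestrict]
  refine G.smooth_mul.continuous.congr ?_
  rintro ⟨p, hp⟩
  exact mul_eq_comp hp

lemma continuous_comp {X : Type*} [TopologicalSpace X] {a b : X → G.Arr}
    (ha : Continuous a) (hb : Continuous b) (h : ∀ x, G.src (a x) = G.tgt (b x)) :
    Continuous (fun x => G.comp (a x) (b x)) :=
  continuousOn_comp.comp_continuous (ha.prodMk hb) h

variable (G) in
/-- The conjugate `g h g⁻¹`. -/
def conj (g h : G.Arr) : G.Arr := G.comp (G.comp g h) (G.inv g)

section Conj

lemma src_conj (e : G.src g = G.tgt h) (e' : G.src h = G.src g) :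
    G.src (G.conj g h) = G.tgt g := by
  rw [conj, src_comp (by rw [src_comp e, G.tgt_inv, e']), G.src_inv]

lemma tgt_conj (e : G.src g = G.tgt h) (e' : G.src h = G.src g) :
    G.tgt (G.conj g h) = G.tgt g := by
  rw [conj, tgt_comp (by rw [src_comp e, G.tgt_inv, e']), tgt_comp e]

lemma conj_comp_self (e : G.src g = G.tgt h) (e' : G.src h = G.src g) :
    G.comp (G.conj g h) g = G.comp g h :=
  inv_comp_cancel_right (by rw [src_comp e, e'])

lemma eq_conj_iff (e : G.src g = G.tgt h) (e' : G.src h = G.src g) (hk : G.src k = G.tgt g) :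
    k = G.conj g h ↔ G.comp k g = G.comp g h := by
  constructor
  · rintro rfl
    exact conj_comp_self e e'
  · intro H
    rw [conj, ← H, comp_inv_cancel_right hk]

lemma conj_comp (e : G.src g = G.tgt h) (e' : G.src h = G.src g) (f : G.src g = G.tgt k)
    (f' : G.src k = G.src g) : G.conj g (G.comp h k) = G.comp (G.conj g h) (G.conj g k) := by
  have hk : G.src h = G.tgt k := e'.trans f
  symm
  rw [eq_conj_iff (by rw [tgt_comp hk, e]) (by rw [src_comp hk, f']),
    comp_assoc (by rw [src_conj e e', tgt_conj f f']) (src_conj f f'), conj_comp_self f f',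
    ← comp_assoc (src_conj e e') f, conj_comp_self e e', comp_assoc e hk]
  rw [src_comp (by rw [src_conj e e', tgt_conj f f']), src_conj f f']

lemma conj_conj {g' : G.Arr} (e : G.src g = G.tgt h) (e' : G.src h = G.src g)
    (eg : G.src g' = G.tgt g) : G.conj g' (G.conj g h) = G.conj (G.comp g' g) h := by
  have htgt := tgt_conj e e'
  have hsrc := src_conj e e'
  rw [eq_conj_iff (by rw [src_comp eg, e]) (by rw [src_comp eg, e']),
    ← comp_assoc (by rw [src_conj (by rw [eg, htgt]) (by rw [hsrc, eg])]) eg,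
    conj_comp_self (by rw [eg, htgt]) (by rw [hsrc, eg]), comp_assoc (by rw [eg, htgt]) hsrc,
    conj_comp_self e e', comp_assoc eg e]
  rw [src_conj (by rw [eg, htgt]) (by rw [hsrc, eg]), tgt_comp eg]

lemma unit_conj {x : G.Obj} (e : x = G.tgt h) (e' : G.src h = x) : G.conj (G.unit x) h = h := by
  rw [conj, unit_comp e, inv_unit, comp_unit e']

lemma inv_conj_conj (e : G.src g = G.tgt h) (e' : G.src h = G.src g) :
    G.conj (G.inv g) (G.conj g h) = h := by
  rw [conj_conj e e' (G.src_inv g), inv_comp, unit_conj e e']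

lemma conj_inv_conj (e : G.tgt g = G.tgt h) (e' : G.src h = G.tgt g) :
    G.conj g (G.conj (G.inv g) h) = h := by
  rw [conj_conj (by rw [G.src_inv, e]) (by rw [G.src_inv, e']) (by rw [G.tgt_inv]), comp_inv,
    unit_conj e e']

lemma conj_injective (e : G.src g = G.tgt h) (e' : G.src h = G.src g) (f : G.src g = G.tgt k)
    (f' : G.src k = G.src g) (H : G.conj g h = G.conj g k) : h = k := by
  rw [← inv_conj_conj e e', H, inv_conj_conj f f']

lemma continuous_conj {X : Type*} [TopologicalSpace X] {a b : X → G.Arr}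
    (ha : Continuous a) (hb : Continuous b) (h : ∀ x, G.src (a x) = G.tgt (b x))
    (h' : ∀ x, G.src (b x) = G.src (a x)) :
    Continuous (fun x => G.conj (a x) (b x)) := by
  refine continuous_comp (continuous_comp ha hb h) (G.smooth_inv.continuous.comp ha) fun x => ?_
  rw [src_comp (h x), h']
  exact (G.tgt_inv _).symm

end Conj

section Action

variable {EK : Type*} [NormedAddCommGroup EK] [NormedSpace ℝ EK] {HK : Type*} [TopologicalSpace HK]
  {IK : ModelWithCorners ℝ EK HK}
  {K : Type*} [TopologicalSpace K] [ChartedSpace HK K] [Group K]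

lemma RightAction.comp_act (α : G.RightAction IK K) (e : G.src g = G.tgt h) (k : K) :
    α.arr (G.comp g h) k = G.comp (α.arr g k) (α.arr h k) := by
  rw [← mul_eq_comp e, α.mul_act, mul_eq_comp]

lemma RightAction.conj_act (α : G.RightAction IK K) (e : G.src g = G.tgt h)
    (e' : G.src h = G.src g) (k : K) :
    α.arr (G.conj g h) k = G.conj (α.arr g k) (α.arr h k) := by
  rw [conj, α.comp_act (by rw [src_comp e, G.tgt_inv, e']), α.comp_act e, α.inv_act, conj]

lemma RightAction.arr_arr_inv (α : G.RightAction IK K) (g : G.Arr) (k : K) :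
    α.arr (α.arr g k⁻¹) k = g := by
  rw [← α.arr_mul, inv_mul_cancel, α.arr_one]

lemma RightAction.arr_inv_arr (α : G.RightAction IK K) (g : G.Arr) (k : K) :
    α.arr (α.arr g k) k⁻¹ = g := by
  rw [← α.arr_mul, mul_inv_cancel, α.arr_one]

lemma RightAction.obj_inv_obj (α : G.RightAction IK K) (x : G.Obj) (k : K) :
    α.obj (α.obj x k) k⁻¹ = x := by
  rw [← α.obj_mul, mul_inv_cancel, α.obj_one]

end Action

variable (G) in
/-- A `T`-frame: an isomorphism from the group `T` onto the stabilizer of an object, recorded as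
a map into the space of arrows. The object is read off as the source of `φ 1`. -/
structure IsFrame {T : Type*} [Group T] (φ : T → G.Arr) : Prop where
  src_eq : ∀ a b, G.src (φ a) = G.src (φ b)
  tgt_eq : ∀ a, G.tgt (φ a) = G.src (φ a)
  map_mul : ∀ a b, φ (a * b) = G.comp (φ a) (φ b)
  injective : Function.Injective φ
  exists_eq : ∀ g, G.src g = G.src (φ 1) → G.tgt g = G.src (φ 1) → ∃ a, φ a = g

variable (G) in
/-- The space of `T`-frames, with the topology of pointwise convergence. -/
abbrev Frame (T : Type v) [Group T] : Type (max u v) := {φ : T → G.Arr // G.IsFrame φ}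

namespace Frame

variable {T : Type v} [Group T] {S : Type w} [Group S]

/-- The object whose stabilizer is framed. -/
def base (φ : G.Frame T) : G.Obj := G.src (φ.1 1)

lemma src_apply (φ : G.Frame T) (a : T) : G.src (φ.1 a) = φ.base := φ.2.src_eq a 1

lemma tgt_apply (φ : G.Frame T) (a : T) : G.tgt (φ.1 a) = φ.base :=
  (φ.2.tgt_eq a).trans (φ.src_apply a)

lemma map_mul (φ : G.Frame T) (a b : T) : φ.1 (a * b) = G.comp (φ.1 a) (φ.1 b) :=
  φ.2.map_mul a b

lemma continuous_apply (a : T) : Continuous (fun φ : G.Frame T => φ.1 a) :=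
  (_root_.continuous_apply a).comp continuous_subtype_val

lemma continuous_base : Continuous (base : G.Frame T → G.Obj) :=
  G.smooth_src.continuous.comp (continuous_apply 1)

/-- The tautological frame of the stabilizer of an object. -/
def ofStab (x : G.Obj) : G.Frame (G.Stab x) :=
  ⟨Stab.arr,
    { src_eq := fun a b => a.src_eq.trans b.src_eq.symm
      tgt_eq := fun a => a.tgt_eq.trans a.src_eq.symm
      map_mul := fun a b => mul_eq_comp (a.src_eq.trans b.tgt_eq.symm)
      injective := fun _ _ h => Stab.ext h
      exists_eq := fun g h h' =>
        ⟨⟨g, h.trans (Stab.src_eq _), h'.trans (Stab.src_eq _)⟩, rfl⟩ }⟩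

lemma base_ofStab (x : G.Obj) : (ofStab x).base = x := Stab.src_eq (1 : G.Stab x)

lemma exists_mulEquiv (φ : G.Frame T) (ψ : G.Frame S) (h : φ.base = ψ.base) :
    ∃ e : S ≃* T, ∀ a, φ.1 (e a) = ψ.1 a := by
  choose e he using fun a =>
    φ.2.exists_eq (ψ.1 a) ((ψ.src_apply a).trans h.symm) ((ψ.tgt_apply a).trans h.symm)
  refine ⟨MulEquiv.ofBijective (MonoidHom.mk' e fun a b => ?_) ⟨fun a b hab => ?_, fun a => ?_⟩, he⟩
  · refine φ.2.injective ?_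
    rw [he, φ.map_mul, he, he, ψ.map_mul]
  · refine ψ.2.injective ?_
    rw [← he, ← he]
    exact congrArg φ.1 hab
  · obtain ⟨b, hb⟩ := ψ.2.exists_eq (φ.1 a) ((φ.src_apply a).trans h) ((φ.tgt_apply a).trans h)
    refine ⟨b, φ.2.injective ?_⟩
    exact (he b).trans hb

/-- Precomposition of a frame with a group isomorphism. -/
def precomp (φ : G.Frame T) (e : S ≃* T) : G.Frame S :=
  ⟨fun a => φ.1 (e a),
    { src_eq := fun a b => φ.2.src_eq _ _
      tgt_eq := fun a => φ.2.tgt_eq _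
      map_mul := fun a b => by rw [_root_.map_mul, φ.map_mul]
      injective := φ.2.injective.comp e.injective
      exists_eq := fun g h h' => by
        rw [_root_.map_one] at h h'
        obtain ⟨a, ha⟩ := φ.2.exists_eq g h h'
        exact ⟨e.symm a, by rw [e.apply_symm_apply, ha]⟩ }⟩

lemma base_precomp (φ : G.Frame T) (e : S ≃* T) : (φ.precomp e).base = φ.base :=
  φ.src_apply _

/-- The frame `a ↦ g φ(a) g⁻¹`. -/
def conj (g : G.Arr) (φ : G.Frame T) (h : G.src g = φ.base) : G.Frame T :=
  ⟨fun a => G.conj g (φ.1 a), by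
    have e : ∀ a, G.src g = G.tgt (φ.1 a) := fun a => h.trans (φ.tgt_apply a).symm
    have e' : ∀ a, G.src (φ.1 a) = G.src g := fun a => (φ.src_apply a).trans h.symm
    exact
    { src_eq := fun a b => by rw [src_conj (e a) (e' a), src_conj (e b) (e' b)]
      tgt_eq := fun a => by rw [src_conj (e a) (e' a), tgt_conj (e a) (e' a)]
      map_mul := fun a b => by rw [φ.map_mul, conj_comp (e a) (e' a) (e b) (e' b)]
      injective := fun a b hab => φ.2.injective (conj_injective (e a) (e' a) (e b) (e' b) hab)
      exists_eq := fun k hk hk' => by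
        rw [src_conj (e 1) (e' 1)] at hk hk'
        have hs : G.src (G.inv g) = G.tgt k := by rw [G.src_inv, hk']
        have hs' : G.src k = G.src (G.inv g) := by rw [G.src_inv, hk]
        obtain ⟨a, ha⟩ := φ.2.exists_eq (G.conj (G.inv g) k)
          (by rw [src_conj hs hs', G.tgt_inv, h]; rfl) (by rw [tgt_conj hs hs', G.tgt_inv, h]; rfl)
        exact ⟨a, by rw [ha, conj_inv_conj hk'.symm hk]⟩ }⟩

section Conj

variable (φ : G.Frame T)

lemma base_conj (h : G.src g = φ.base) : (φ.conj g h).base = G.tgt g :=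
  src_conj (h.trans (φ.tgt_apply 1).symm) ((φ.src_apply 1).trans h.symm)

lemma conj_unit (h : G.src (G.unit φ.base) = φ.base) : φ.conj (G.unit φ.base) h = φ :=
  Subtype.ext (funext fun a => unit_conj (φ.tgt_apply a).symm (φ.src_apply a))

lemma conj_conj (h : G.src g = φ.base) {g' : G.Arr} (h' : G.src g' = (φ.conj g h).base)
    (h'' : G.src (G.comp g' g) = φ.base) :
    (φ.conj g h).conj g' h' = φ.conj (G.comp g' g) h'' :=
  Subtype.ext (funext fun a => SmoothGroupoid.conj_conj (h.trans (φ.tgt_apply a).symm)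
    ((φ.src_apply a).trans h.symm) (h'.trans (φ.base_conj h)))

lemma conj_inv_conj (h : G.src g = φ.base) (h' : G.src (G.inv g) = (φ.conj g h).base) :
    (φ.conj g h).conj (G.inv g) h' = φ :=
  Subtype.ext (funext fun a => inv_conj_conj (h.trans (φ.tgt_apply a).symm)
    ((φ.src_apply a).trans h.symm))

lemma conj_congr {φ ψ : G.Frame T} {g g' : G.Arr} (hφ : φ = ψ) (hg : g = g')
    (h : G.src g = φ.base) (h' : G.src g' = ψ.base) : φ.conj g h = ψ.conj g' h' := by
  subst hφ hg; rfl

lemma continuous_conj {X : Type*} [TopologicalSpace X] {a : X → G.Arr}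
    {b : X → G.Frame T} (ha : Continuous a) (hb : Continuous b)
    (h : ∀ x, G.src (a x) = (b x).base) :
    Continuous (fun x => (b x).conj (a x) (h x)) := by
  refine Continuous.subtype_mk (continuous_pi fun c => ?_) _
  exact SmoothGroupoid.continuous_conj ha ((continuous_apply c).comp hb)
    (fun x => (h x).trans ((b x).tgt_apply c).symm) (fun x => ((b x).src_apply c).trans (h x).symm)

end Conj

section Action

variable {EK : Type*} [NormedAddCommGroup EK] [NormedSpace ℝ EK] {HK : Type*} [TopologicalSpace HK]
  {IK : ModelWithCorners ℝ EK HK}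
  {K : Type*} [TopologicalSpace K] [ChartedSpace HK K] [Group K] (α : G.RightAction IK K)

/-- The translate of a frame by a group acting on the groupoid. -/
def translate (φ : G.Frame T) (k : K) : G.Frame T :=
  ⟨fun a => α.arr (φ.1 a) k,
    { src_eq := fun a b => by rw [α.src_act, α.src_act, φ.src_apply, φ.src_apply]
      tgt_eq := fun a => by rw [α.src_act, α.tgt_act, φ.src_apply, φ.tgt_apply]
      map_mul := fun a b => by
        rw [φ.map_mul, α.comp_act ((φ.src_apply a).trans (φ.tgt_apply b).symm)]
      injective := fun a b hab => φ.2.injective (by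
        rw [← α.arr_inv_arr (φ.1 a) k, ← α.arr_inv_arr (φ.1 b) k]
        exact congrArg (fun g => α.arr g k⁻¹) hab)
      exists_eq := fun g h h' => by
        rw [α.src_act] at h h'
        obtain ⟨a, ha⟩ := φ.2.exists_eq (α.arr g k⁻¹)
          (by rw [α.src_act, h, α.obj_inv_obj]) (by rw [α.tgt_act, h', α.obj_inv_obj])
        exact ⟨a, by rw [ha, α.arr_arr_inv]⟩ }⟩

lemma base_translate (φ : G.Frame T) (k : K) : (φ.translate α k).base = α.obj φ.base k :=
  α.src_act _ _

end Action

end Frame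

section LocalSection

variable {G : SmoothGroupoid.{u}} [hG : G.IsEtale] {g h : G.Arr} {x : G.Obj}

variable (G) in
/-- The local section of the source map of an étale groupoid through the arrow `g`. Its values are
meaningful only near `G.src g`. -/
def localSection (g : G.Arr) : G.Obj → G.Arr := (hG.etale g).localInverse

lemma tendsto_localSection (hx : G.src g = x) :
    Filter.Tendsto (G.localSection g) (𝓝 x) (𝓝 g) := by
  subst hx
  have hg : G.localSection g (G.src g) = g :=
    (hG.etale g).localInverse_left_inv (hG.etale g).localInverse_mem_target
  have hlim : Filter.Tendsto (G.localSection g) (𝓝 (G.src g)) (𝓝 (G.localSection g (G.src g))) :=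
    (hG.etale g).localInverse_contMDiffAt.continuousAt
  rwa [hg] at hlim

lemma eventually_src_localSection (hx : G.src g = x) :
    ∀ᶠ y in 𝓝 x, G.src (G.localSection g y) = y := by
  subst hx
  exact (hG.etale g).localInverse_eventuallyEq_right

lemma eventually_localSection_src (g : G.Arr) :
    ∀ᶠ h in 𝓝 g, G.localSection g (G.src h) = h :=
  (hG.etale g).localInverse_eventuallyEq_left

lemma eventually_tgt_localSection (hx : G.src g = x) (hg : g ∈ G.ineffectiveSpace) :
    ∀ᶠ y in 𝓝 x, G.tgt (G.localSection g y) = y := by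
  filter_upwards [eventually_src_localSection hx,
    (tendsto_localSection hx).eventually ((G.mem_ineffectiveSpace_iff g).1 hg)] with y hsrc htgt
  rw [← htgt, hsrc]

lemma eventually_localSection_comp (hx : G.src g = x) (hx' : G.src h = x)
    (hh : h ∈ G.ineffectiveSpace) :
    ∀ᶠ y in 𝓝 x, G.localSection (G.comp g h) y =
      G.comp (G.localSection g y) (G.localSection h y) := by
  have hgh : G.src g = G.tgt h := by
    rw [hx, ← hx', ((G.mem_ineffectiveSpace_iff h).1 hh).self_of_nhds]
  have hcomposable : ∀ᶠ y in 𝓝 x, G.src (G.localSection g y) = G.tgt (G.localSection h y) := by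
    filter_upwards [eventually_src_localSection hx, eventually_tgt_localSection hx' hh]
      with y hg hh using hg.trans hh.symm
  have hlim : Filter.Tendsto (fun y => G.comp (G.localSection g y) (G.localSection h y)) (𝓝 x)
      (𝓝 (G.comp g h)) :=
    (continuousOn_comp (g, h) hgh).tendsto.comp (tendsto_nhdsWithin_iff.2
      ⟨(tendsto_localSection hx).prodMk_nhds (tendsto_localSection hx'), hcomposable⟩)
  filter_upwards [hcomposable, hlim.eventually (eventually_localSection_src (G.comp g h)),
    eventually_src_localSection hx'] with y hy hsection hsrc
  rwa [src_comp hy, hsrc] at hsection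

lemma eventually_localSection_ne (hx : G.src g = x) (hx' : G.src h = x) (hgh : g ≠ h) :
    ∀ᶠ y in 𝓝 x, G.localSection g y ≠ G.localSection h y :=
  ((tendsto_localSection hx).prodMk_nhds (tendsto_localSection hx')).eventually
    (isClosed_diagonal.isOpen_compl.mem_nhds hgh)

end LocalSection

lemma eventually_exists_localSection_eq {G : SmoothGroupoid.{u}} [hG : G.IsOrbifold] (x : G.Obj) :
    ∀ᶠ y in 𝓝 x, ∀ k, G.src k = y → G.tgt k = y →
      ∃ g, G.src g = x ∧ G.tgt g = x ∧ G.localSection g y = k := by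
  have hfiber : ∀ᶠ z in 𝓝 (x, x), ∀ k ∈ (fun g => (G.src g, G.tgt g)) ⁻¹' {z},
      ∃ g, G.src g = x ∧ G.tgt g = x ∧ G.localSection g (G.src k) = k := by
    refine hG.proper.isClosedMap.eventually_nhds_fiber (x, x) fun g hg => ?_
    filter_upwards [eventually_localSection_src g] with k hk
    exact ⟨g, congrArg Prod.fst hg, congrArg Prod.snd hg, hk⟩
  have hdiag : Continuous fun y : G.Obj => (y, y) := continuous_id.prodMk continuous_id
  filter_upwards [hdiag.continuousAt.eventually hfiber] with y hy k hsrc htgt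
  obtain ⟨g, hg, hg', hgk⟩ := hy k (Prod.ext hsrc htgt)
  exact ⟨g, hg, hg', hsrc ▸ hgk⟩

/-! ### The frame space is étale over the space of objects -/

namespace Frame

variable {G : SmoothGroupoid.{u}} {T : Type v} [Group T] {S : Type w} [Group S]

lemma isLocallyInjective_base [G.IsEtale] [Finite T] :
    IsLocallyInjective (base : G.Frame T → G.Obj) := by
  intro φ
  have hnhds : ∀ᶠ ψ in 𝓝 φ, ∀ a, G.localSection (φ.1 a) (G.src (ψ.1 a)) = ψ.1 a :=
    Filter.eventually_all.2 fun a =>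
      (continuous_apply a).continuousAt.eventually (eventually_localSection_src (φ.1 a))
  obtain ⟨U, hUφ, hU, hφU⟩ := eventually_nhds_iff.1 hnhds
  refine ⟨U, hU, hφU, fun ψ hψ ψ' hψ' h => Subtype.ext (funext fun a => ?_)⟩
  rw [← hUφ ψ hψ a, ← hUφ ψ' hψ' a, ψ.src_apply, ψ'.src_apply, h]

variable [hG : G.IsOrbifold]

lemma eventually_isFrame [Finite T] (hPI : G.IsPurelyIneffective) (φ : G.Frame T) :
    ∀ᶠ y in 𝓝 φ.base, G.IsFrame (fun a => G.localSection (φ.1 a) y) ∧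
      ∀ a, G.src (G.localSection (φ.1 a) y) = y := by
  have hineff (a : T) : φ.1 a ∈ G.ineffectiveSpace := hPI ▸ (φ.2.tgt_eq a).symm
  have hmul (a b : T) : ∀ᶠ y in 𝓝 φ.base, G.localSection (φ.1 (a * b)) y =
      G.comp (G.localSection (φ.1 a) y) (G.localSection (φ.1 b) y) := by
    rw [φ.map_mul]
    exact eventually_localSection_comp (φ.src_apply a) (φ.src_apply b) (hineff b)
  have hne (a b : T) : ∀ᶠ y in 𝓝 φ.base, a ≠ b →
      G.localSection (φ.1 a) y ≠ G.localSection (φ.1 b) y := by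
    refine Filter.eventually_imp_distrib_left.2 fun hab => ?_
    exact eventually_localSection_ne (φ.src_apply a) (φ.src_apply b) (φ.2.injective.ne hab)
  filter_upwards [Filter.eventually_all.2 fun a => eventually_src_localSection (φ.src_apply a),
    Filter.eventually_all.2 fun a => eventually_tgt_localSection (φ.src_apply a) (hineff a),
    Filter.eventually_all.2 fun a => Filter.eventually_all.2 (hmul a),
    Filter.eventually_all.2 fun a => Filter.eventually_all.2 (hne a),
    eventually_exists_localSection_eq φ.base] with y hsrc htgt hmul hne hsurj
  refine ⟨⟨fun a b => by rw [hsrc, hsrc], fun a => by rw [hsrc, htgt], hmul,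
    fun a b => not_imp_not.1 (hne a b), fun k hk hk' => ?_⟩, hsrc⟩
  rw [hsrc] at hk hk'
  obtain ⟨g, hg, hg', rfl⟩ := hsurj k hk hk'
  obtain ⟨a, rfl⟩ := φ.2.exists_eq g hg hg'
  exact ⟨a, rfl⟩

lemma isOpenMap_base [Finite T] (hPI : G.IsPurelyIneffective) :
    IsOpenMap (base : G.Frame T → G.Obj) := by
  refine isOpenMap_iff_nhds_le.2 fun φ s hs => ?_
  obtain ⟨W, hW, hWs⟩ := (mem_nhds_induced Subtype.val φ _).1 hs
  have hsection : Filter.Tendsto (fun y a => G.localSection (φ.1 a) y) (𝓝 φ.base) (𝓝 φ.1) :=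
    tendsto_pi_nhds.2 fun a => tendsto_localSection (φ.src_apply a)
  filter_upwards [eventually_isFrame hPI φ, hsection hW] with y ⟨hframe, hsrc⟩ hy
  have hbase : base ⟨_, hframe⟩ ∈ s := hWs (show ⟨_, hframe⟩ ∈ Subtype.val ⁻¹' W from hy)
  rwa [show base ⟨_, hframe⟩ = y from hsrc 1] at hbase

lemma isLocalHomeomorph_base [Finite T] (hPI : G.IsPurelyIneffective) :
    IsLocalHomeomorph (base : G.Frame T → G.Obj) :=
  isLocalHomeomorph_of_isLocallyInjective continuous_base (isOpenMap_base hPI)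
    isLocallyInjective_base

end Frame

section Connected

variable {G : SmoothGroupoid.{u}} {T : Type v} [Group T]

lemma nonempty_mulEquiv_stab_iff {x : G.Obj} :
    Nonempty (T ≃* G.Stab x) ↔ ∃ φ : G.Frame T, φ.base = x := by
  constructor
  · rintro ⟨e⟩
    exact ⟨(Frame.ofStab x).precomp e, by rw [Frame.base_precomp, Frame.base_ofStab]⟩
  · rintro ⟨φ, hφ⟩
    obtain ⟨e, -⟩ := (Frame.ofStab x).exists_mulEquiv φ ((Frame.base_ofStab x).trans hφ.symm)
    exact ⟨e⟩

lemma nonempty_mulEquiv_stab_tgt (g : G.Arr) :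
    Nonempty (G.Stab (G.src g) ≃* G.Stab (G.tgt g)) :=
  nonempty_mulEquiv_stab_iff.2 ⟨(Frame.ofStab _).conj g (Frame.base_ofStab _).symm,
    Frame.base_conj _ _⟩

lemma eventually_nonempty_mulEquiv_stab [hG : G.IsOrbifold] (hPI : G.IsPurelyIneffective)
    (x : G.Obj) : ∀ᶠ y in 𝓝 x, Nonempty (G.Stab x ≃* G.Stab y) := by
  have hframe := Frame.eventually_isFrame hPI (Frame.ofStab x)
  rw [Frame.base_ofStab] at hframe
  filter_upwards [hframe] with y hy
  exact nonempty_mulEquiv_stab_iff.2 ⟨⟨_, hy.1⟩, hy.2 1⟩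

lemma IsConnected.eq_of_isLocallyConstant (hconn : G.IsConnected) {A : Type*} {f : G.Obj → A}
    (hf : IsLocallyConstant f) (hinv : ∀ g, f (G.src g) = f (G.tgt g)) (x y : G.Obj) :
    f x = f y := by
  have : ConnectedSpace G.Coarse := hconn
  let F : G.Coarse → A := Quotient.lift f <| by
    rintro _ _ ⟨g, rfl, rfl⟩
    exact hinv g
  have hF : IsLocallyConstant F := fun s => isQuotientMap_quotient_mk'.isOpen_preimage.1 (hf s)
  exact hF.apply_eq_of_preconnectedSpace ⟦x⟧ ⟦y⟧

lemma IsConnected.nonempty_mulEquiv_stab [G.IsOrbifold] (hconn : G.IsConnected)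
    (hPI : G.IsPurelyIneffective) (x y : G.Obj) : Nonempty (G.Stab x ≃* G.Stab y) := by
  have hlocal : IsLocallyConstant fun y => Nonempty (G.Stab x ≃* G.Stab y) := by
    refine (IsLocallyConstant.iff_eventually_eq _).2 fun y => ?_
    filter_upwards [eventually_nonempty_mulEquiv_stab hPI y] with z ⟨e⟩
    exact propext ⟨fun ⟨d⟩ => ⟨d.trans e.symm⟩, fun ⟨d⟩ => ⟨d.trans e⟩⟩
  have hinv (g : G.Arr) :
      Nonempty (G.Stab x ≃* G.Stab (G.src g)) = Nonempty (G.Stab x ≃* G.Stab (G.tgt g)) := by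
    obtain ⟨e⟩ := nonempty_mulEquiv_stab_tgt g
    exact propext ⟨fun ⟨d⟩ => ⟨d.trans e⟩, fun ⟨d⟩ => ⟨d.trans e.symm⟩⟩
  exact cast (hconn.eq_of_isLocallyConstant hlocal hinv x y) ⟨MulEquiv.refl _⟩

end Connected

variable {G : SmoothGroupoid.{u}} {T : Type u} [Group T]

variable (G T) in
/-- The arrows of the action groupoid of `G` on the space of frames: pairs of an arrow of `G` and
a frame at its source. -/
abbrev FrameArr : Type u := {p : G.Arr × G.Frame T // G.src p.1 = p.2.base}

namespace FrameArr

/-- The arrow of `G`. -/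
def arr (p : G.FrameArr T) : G.Arr := p.1.1

/-- The frame at the source. -/
def src (p : G.FrameArr T) : G.Frame T := p.1.2

lemma src_arr (p : G.FrameArr T) : G.src p.arr = p.src.base := p.2

/-- The frame at the target. -/
def tgt (p : G.FrameArr T) : G.Frame T := p.src.conj p.arr p.src_arr

lemma base_tgt (p : G.FrameArr T) : p.tgt.base = G.tgt p.arr := p.src.base_conj _

@[ext]
lemma ext {p q : G.FrameArr T} (ha : p.arr = q.arr) (hs : p.src = q.src) : p = q :=
  Subtype.ext (Prod.ext ha hs)

/-- The arrow out of a frame `φ` given by an arrow out of its base. -/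
def mk (g : G.Arr) (φ : G.Frame T) (h : G.src g = φ.base) : G.FrameArr T := ⟨(g, φ), h⟩

lemma src_mk (g : G.Arr) (φ : G.Frame T) (h : G.src g = φ.base) : (mk g φ h).src = φ := rfl

lemma continuous_arr : Continuous (arr : G.FrameArr T → G.Arr) :=
  continuous_fst.comp continuous_subtype_val

lemma continuous_src : Continuous (src : G.FrameArr T → G.Frame T) :=
  continuous_snd.comp continuous_subtype_val

lemma continuous_tgt : Continuous (tgt : G.FrameArr T → G.Frame T) :=
  Frame.continuous_conj continuous_arr continuous_src src_arr

lemma continuous_mk {X : Type*} [TopologicalSpace X] {a : X → G.Arr} {b : X → G.Frame T}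
    (ha : Continuous a) (hb : Continuous b) (h : ∀ x, G.src (a x) = (b x).base) :
    Continuous (fun x => mk (a x) (b x) (h x)) :=
  (ha.prodMk hb).subtype_mk _

/-- The identity of a frame. -/
def unit (φ : G.Frame T) : G.FrameArr T := mk (G.unit φ.base) φ (G.src_unit _)

/-- The inverse of an arrow between frames. -/
def inv (p : G.FrameArr T) : G.FrameArr T :=
  mk (G.inv p.arr) p.tgt (by rw [G.src_inv, p.base_tgt])

lemma src_arr_eq_of_src_eq {p q : G.FrameArr T} (e : p.src = q.tgt) :
    G.src p.arr = G.tgt q.arr := by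
  rw [p.src_arr, e, q.base_tgt]

/-- The composite of two arrows between frames. -/
def mul (p q : G.FrameArr T) (e : p.src = q.tgt) : G.FrameArr T :=
  mk (G.comp p.arr q.arr) q.src (by rw [src_comp (src_arr_eq_of_src_eq e), q.src_arr])

lemma tgt_unit (φ : G.Frame T) : (unit φ).tgt = φ := φ.conj_unit _

lemma tgt_inv (p : G.FrameArr T) : p.inv.tgt = p.src := p.src.conj_inv_conj p.src_arr _

lemma tgt_mul (p q : G.FrameArr T) (e : p.src = q.tgt) : (mul p q e).tgt = p.tgt := by
  have h : G.src p.arr = (q.src.conj q.arr q.src_arr).base :=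
    p.src_arr.trans (congrArg Frame.base e)
  exact (q.src.conj_conj q.src_arr h _).symm.trans (Frame.conj_congr e.symm rfl _ _)

lemma continuous_mul : Continuous (fun p : {p : G.FrameArr T × G.FrameArr T | p.1.src = p.2.tgt} =>
    mul p.1.1 p.1.2 p.2) :=
  continuous_mk (continuous_comp
    (continuous_arr.comp (continuous_fst.comp continuous_subtype_val))
    (continuous_arr.comp (continuous_snd.comp continuous_subtype_val))
    fun p => src_arr_eq_of_src_eq p.2)
    (continuous_src.comp (continuous_snd.comp continuous_subtype_val)) _

lemma isLocalHomeomorph_src [hG : G.IsEtale] :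
    IsLocalHomeomorph (src : G.FrameArr T → G.Frame T) :=
  isLocalHomeomorph_pullback_snd hG.etale.isLocalHomeomorph Frame.continuous_base

variable [hG : G.IsOrbifold]

lemma isProperMap_src_tgt : IsProperMap (fun p : G.FrameArr T => (p.src, p.tgt)) := by
  have hclosed : Topology.IsClosedEmbedding (Subtype.val : G.FrameArr T → G.Arr × G.Frame T) :=
    (isClosed_eq (G.smooth_src.continuous.comp continuous_fst)
      (Frame.continuous_base.comp continuous_snd)).isClosedEmbedding_subtypeVal
  have hproper : IsProperMap fun p : G.FrameArr T => ((G.src p.arr, G.tgt p.arr), p.src) :=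
    (hG.proper.prodMap isProperMap_id).comp hclosed.isProperMap
  refine isProperMap_of_comp_of_t2 (g := fun q : G.Frame T × G.Frame T =>
    ((q.1.base, q.2.base), q.1)) (continuous_src.prodMk continuous_tgt) ?_ ?_
  · exact ((Frame.continuous_base.comp continuous_fst).prodMk
      (Frame.continuous_base.comp continuous_snd)).prodMk continuous_fst
  · convert hproper using 1
    funext p
    exact Prod.ext (Prod.ext p.src_arr.symm p.base_tgt) rfl

lemma isLocalHomeomorph_base_src [Finite T] (hPI : G.IsPurelyIneffective) :
    IsLocalHomeomorph (fun p : G.FrameArr T => p.src.base) :=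
  (Frame.isLocalHomeomorph_base hPI).comp isLocalHomeomorph_src

end FrameArr

instance [Countable T] : SecondCountableTopology (G.Frame T) :=
  Topology.IsInducing.subtypeVal.secondCountableTopology

instance [Countable T] : SecondCountableTopology (G.FrameArr T) :=
  Topology.IsInducing.subtypeVal.secondCountableTopology

variable [hG : G.IsOrbifold] [Finite T] (hPI : G.IsPurelyIneffective)

variable (T) in
/-- The manifold of frames, étale over the objects of `G` by `Frame.base`. -/
def frameMfd : Mfd.{u} := Mfd.etale (Frame.isLocalHomeomorph_base (T := T) hPI)

variable (T) in
/-- The manifold of arrows between frames, étale over the objects of `G` by the base of the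
source. -/
def frameArrMfd : Mfd.{u} := Mfd.etale (FrameArr.isLocalHomeomorph_base_src (T := T) hPI)

lemma isLocalDiffeomorph_frameBase :
    IsLocalDiffeomorph (M := frameMfd T hPI) (frameMfd T hPI).I G.Obj.I ∞ Frame.base :=
  isLocalDiffeomorph_etale (I := G.Obj.I) (Frame.isLocalHomeomorph_base hPI)

lemma isLocalDiffeomorph_frameArrBase :
    IsLocalDiffeomorph (M := frameArrMfd T hPI) (frameArrMfd T hPI).I G.Obj.I ∞
      (fun p : G.FrameArr T => p.src.base) :=
  isLocalDiffeomorph_etale (I := G.Obj.I) (FrameArr.isLocalHomeomorph_base_src hPI)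

lemma isLocalDiffeomorph_frameArrSrc :
    IsLocalDiffeomorph (M := frameArrMfd T hPI) (N := frameMfd T hPI)
      (frameArrMfd T hPI).I (frameMfd T hPI).I ∞ FrameArr.src :=
  isLocalDiffeomorph_of_comp (M := frameArrMfd T hPI) (N := frameMfd T hPI)
    (isLocalDiffeomorph_frameBase hPI) FrameArr.continuous_src (isLocalDiffeomorph_frameArrBase hPI)

lemma isLocalDiffeomorph_frameArrArr :
    IsLocalDiffeomorph (M := frameArrMfd T hPI) (frameArrMfd T hPI).I G.Arr.I ∞ FrameArr.arr := by
  refine isLocalDiffeomorph_of_comp (M := frameArrMfd T hPI) hG.etale FrameArr.continuous_arr ?_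
  rw [show (fun p : frameArrMfd T hPI => G.src (FrameArr.arr p)) =
    fun p : G.FrameArr T => p.src.base from funext FrameArr.src_arr]
  exact isLocalDiffeomorph_frameArrBase hPI

section Smooth

variable {E' : Type*} [NormedAddCommGroup E'] [NormedSpace ℝ E'] {H' : Type*} [TopologicalSpace H']
  {I' : ModelWithCorners ℝ E' H'} {N : Type*} [TopologicalSpace N] [ChartedSpace H' N]

lemma contMDiff_frameMfd {f : N → G.Frame T} (hf : Continuous f)
    (h : ContMDiff I' G.Obj.I ∞ (fun x => (f x).base)) :
    ContMDiff (M' := frameMfd T hPI) I' (frameMfd T hPI).I ∞ f :=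
  contMDiff_of_isLocalDiffeomorph_comp (N := frameMfd T hPI) (isLocalDiffeomorph_frameBase hPI) hf h

lemma contMDiff_frameArrMfd {f : N → G.FrameArr T} (hf : Continuous f)
    (h : ContMDiff I' G.Obj.I ∞ (fun x => (f x).src.base)) :
    ContMDiff (M' := frameArrMfd T hPI) I' (frameArrMfd T hPI).I ∞ f :=
  contMDiff_of_isLocalDiffeomorph_comp (N := frameArrMfd T hPI)
    (isLocalDiffeomorph_frameArrBase hPI) hf h

lemma smoothOnSubset_frameArrMfd {A : Set N} {f : A → G.FrameArr T} (hf : Continuous f)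
    {F : N → G.Obj} (hF : ContMDiff I' G.Obj.I ∞ F) (h : ∀ a : A, F a = (f a).src.base) :
    SmoothOnSubset (N := frameArrMfd T hPI) I' (frameArrMfd T hPI).I A f :=
  SmoothOnSubset.of_isLocalDiffeomorph (N := frameArrMfd T hPI)
    (isLocalDiffeomorph_frameArrBase hPI) hf hF h

end Smooth

variable (T) in
/-- The action groupoid of `G` on its space of `T`-frames. -/
def frameGroupoid : SmoothGroupoid.{u} where
  Obj := frameMfd T hPI
  Arr := frameArrMfd T hPI
  src := FrameArr.src
  tgt := FrameArr.tgt
  unit := FrameArr.unit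
  inv := FrameArr.inv
  mul := FrameArr.mul
  src_unit _ := rfl
  tgt_unit := FrameArr.tgt_unit
  src_inv _ := rfl
  tgt_inv := FrameArr.tgt_inv
  src_mul _ _ _ := rfl
  tgt_mul := FrameArr.tgt_mul
  mul_assoc g h k e e' := FrameArr.ext
    (comp_assoc (FrameArr.src_arr_eq_of_src_eq e) (FrameArr.src_arr_eq_of_src_eq e')).symm rfl
  mul_unit g := FrameArr.ext (comp_unit (FrameArr.src_arr g)) rfl
  unit_mul g := FrameArr.ext (unit_comp (FrameArr.base_tgt g)) rfl
  inv_mul g := FrameArr.ext ((inv_comp _).trans (congrArg G.unit (FrameArr.src_arr g))) rfl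
  mul_inv g := FrameArr.ext
    ((comp_inv _).trans (congrArg G.unit (FrameArr.base_tgt g).symm)) rfl
  smooth_src := (isLocalDiffeomorph_frameArrSrc hPI).contMDiff
  smooth_tgt := by
    refine contMDiff_frameMfd hPI (N := frameArrMfd T hPI) FrameArr.continuous_tgt ?_
    exact (G.smooth_tgt.comp (isLocalDiffeomorph_frameArrArr hPI).contMDiff).congr
      fun p => FrameArr.base_tgt p
  smooth_unit := by
    refine contMDiff_frameArrMfd hPI (N := frameMfd T hPI) ?_
      (isLocalDiffeomorph_frameBase hPI).contMDiff
    exact FrameArr.continuous_mk (G.smooth_unit.continuous.comp Frame.continuous_base)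
      continuous_id _
  smooth_inv := by
    refine contMDiff_frameArrMfd hPI (N := frameArrMfd T hPI) ?_ ?_
    · exact FrameArr.continuous_mk (G.smooth_inv.continuous.comp FrameArr.continuous_arr)
        FrameArr.continuous_tgt _
    · exact (G.smooth_tgt.comp (isLocalDiffeomorph_frameArrArr hPI).contMDiff).congr
        fun p => FrameArr.base_tgt p
  smooth_mul := smoothOnSubset_frameArrMfd (N := frameArrMfd T hPI × frameArrMfd T hPI) hPI
    FrameArr.continuous_mul
    ((isLocalDiffeomorph_frameArrBase hPI).contMDiff.comp contMDiff_snd) fun _ => rfl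
  submersion_src := .of_isLocalDiffeomorph (isLocalDiffeomorph_frameArrSrc hPI)

instance : (frameGroupoid T hPI).IsOrbifold where
  etale := isLocalDiffeomorph_frameArrSrc hPI
  proper := FrameArr.isProperMap_src_tgt

lemma isPurelyIneffective_frameGroupoid : (frameGroupoid T hPI).IsPurelyIneffective := by
  refine Set.Subset.antisymm (fun p hp => hp.1) fun (p : G.FrameArr T) (hp : p.src = p.tgt) => ?_
  refine (mem_ineffectiveSpace_iff (frameGroupoid T hPI) p).2 ?_
  change ∀ᶠ q : G.FrameArr T in 𝓝 p, q.src = q.tgt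
  have hg : p.arr ∈ G.ineffectiveSpace := by
    rw [hPI]
    exact FrameArr.src_arr_eq_of_src_eq hp
  obtain ⟨U, hU, hpU, hinj⟩ := (Frame.isLocalHomeomorph_base hPI).isLocallyInjective p.src
  have hisotropy := FrameArr.continuous_arr.continuousAt.eventually
    ((G.mem_ineffectiveSpace_iff _).1 hg)
  have hsrc := FrameArr.continuous_src.continuousAt.preimage_mem_nhds (hU.mem_nhds hpU)
  have htgt := FrameArr.continuous_tgt.continuousAt.preimage_mem_nhds (hU.mem_nhds (hp ▸ hpU))
  filter_upwards [hisotropy, hsrc, htgt] with q hq hqsrc hqtgt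
  refine hinj hqsrc hqtgt ?_
  rw [q.base_tgt, ← hq, q.src_arr]

end SmoothGroupoid

/-- The element of `A` underlying an element of the discrete manifold `Disc A`. -/
def Disc.out {A : Type u} (a : Disc A) : A := a

namespace SmoothGroupoid

/-! ### The action of `K × Aut T` on the frame groupoid -/

lemma Frame.conj_apply_eq_self_iff {G : SmoothGroupoid.{u}} {T : Type v} [Group T]
    (φ : G.Frame T) (z : T) :
    φ.conj (φ.1 z) (φ.src_apply z) = φ ↔ z ∈ Subgroup.center T := by
  have hcomm (b : T) : (φ.conj (φ.1 z) (φ.src_apply z)).1 b = φ.1 b ↔ b * z = z * b := by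
    change G.conj (φ.1 z) (φ.1 b) = φ.1 b ↔ _
    rw [eq_comm, eq_conj_iff ((φ.src_apply z).trans (φ.tgt_apply b).symm)
      ((φ.src_apply b).trans (φ.src_apply z).symm) ((φ.src_apply b).trans (φ.tgt_apply z).symm),
      ← φ.map_mul, ← φ.map_mul, φ.2.injective.eq_iff]
  rw [Subgroup.mem_center_iff, Subtype.ext_iff, funext_iff]
  exact forall_congr' hcomm

section Action

variable {G : SmoothGroupoid.{u}} {T : Type u} [Group T]
  {EK : Type*} [NormedAddCommGroup EK] [NormedSpace ℝ EK] {HK : Type*} [TopologicalSpace HK]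
  {IK : ModelWithCorners ℝ EK HK}
  {K : Type*} [TopologicalSpace K] [ChartedSpace HK K] [Group K] (α : G.RightAction IK K)

/-- The right action of `K × Aut T` on frames: `K` translates and `Aut T` precomposes. -/
def Frame.act (φ : G.Frame T) (k : K × Disc (MulAut T)) : G.Frame T :=
  (φ.precomp k.2.out).translate α k.1

lemma Frame.base_act (φ : G.Frame T) (k : K × Disc (MulAut T)) :
    (φ.act α k).base = α.obj φ.base k.1 := by
  rw [act, base_translate, base_precomp]

lemma Frame.act_one (φ : G.Frame T) : φ.act α 1 = φ :=
  Subtype.ext (funext fun _ => α.arr_one _)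

lemma Frame.act_one_left (φ : G.Frame T) (l : Disc (MulAut T)) :
    φ.act α (1, l) = φ.precomp l.out :=
  Subtype.ext (funext fun _ => α.arr_one _)

lemma Frame.act_mul (φ : G.Frame T) (k l : K × Disc (MulAut T)) :
    φ.act α (k * l) = (φ.act α k).act α l :=
  Subtype.ext (funext fun _ => α.arr_mul _ _ _)

lemma Frame.conj_act (φ : G.Frame T) {g : G.Arr} (h : G.src g = φ.base)
    (k : K × Disc (MulAut T)) (h' : G.src (α.arr g k.1) = (φ.act α k).base) :
    (φ.conj g h).act α k = (φ.act α k).conj (α.arr g k.1) h' :=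
  Subtype.ext (funext fun _ => α.conj_act (h.trans (φ.tgt_apply _).symm)
    ((φ.src_apply _).trans h.symm) _)

lemma Frame.continuous_act :
    Continuous (fun p : G.Frame T × (K × Disc (MulAut T)) => p.1.act α p.2) := by
  refine Continuous.subtype_mk (continuous_pi fun a => ?_) _
  refine α.smooth_arr.continuous.comp (f := fun p : G.Frame T × (K × Disc (MulAut T)) =>
    (p.1.1 (p.2.2.out a), p.2.1)) (Continuous.prodMk ?_
      (continuous_fst.comp continuous_snd))
  have heval : Continuous (fun q : Disc (MulAut T) × G.Frame T => q.2.1 (q.1.out a)) :=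
    continuous_prod_of_discrete_left.2 fun l => Frame.continuous_apply (l.out a)
  exact heval.comp (f := fun p : G.Frame T × (K × Disc (MulAut T)) => (p.2.2, p.1))
    ((continuous_snd.comp continuous_snd).prodMk continuous_fst)

/-- The right action of `K × Aut T` on arrows between frames. -/
def FrameArr.act (p : G.FrameArr T) (k : K × Disc (MulAut T)) : G.FrameArr T :=
  mk (α.arr p.arr k.1) (p.src.act α k) (by rw [α.src_act, Frame.base_act, p.src_arr])

lemma FrameArr.src_arr_eq_of_act_eq {g : G.FrameArr T × Disc (MulAut T)} {p : G.FrameArr T}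
    (e : g.1.src.act α (1, g.2) = p.src) : G.src p.arr = G.src g.1.arr := by
  rw [p.src_arr, ← e, Frame.base_act, α.obj_one, g.1.src_arr]

lemma FrameArr.tgt_act (p : G.FrameArr T) (k : K × Disc (MulAut T)) :
    (p.act α k).tgt = p.tgt.act α k :=
  (p.src.conj_act α p.src_arr k _).symm

lemma FrameArr.continuous_act :
    Continuous (fun p : G.FrameArr T × (K × Disc (MulAut T)) => p.1.act α p.2) :=
  continuous_mk
    (α.smooth_arr.continuous.comp ((continuous_arr.comp continuous_fst).prodMk
      (continuous_fst.comp continuous_snd)))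
    ((Frame.continuous_act α).comp ((continuous_src.comp continuous_fst).prodMk continuous_snd)) _

/-- The arrow from a frame `φ` to itself given by a central element of `T`. -/
def FrameArr.ofCenter (q : G.Frame T × Disc (Subgroup.center T)) : G.FrameArr T :=
  mk (q.1.1 q.2.out) q.1 (q.1.src_apply _)

lemma FrameArr.tgt_ofCenter (q : G.Frame T × Disc (Subgroup.center T)) : (ofCenter q).tgt = q.1 :=
  (q.1.conj_apply_eq_self_iff _).2 q.2.out.2

lemma FrameArr.range_ofCenter :
    Set.range (ofCenter : _ → G.FrameArr T) = {p | p.src = p.tgt} := by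
  refine Set.Subset.antisymm (Set.range_subset_iff.2 fun q => (tgt_ofCenter q).symm) ?_
  intro p (hp : p.src = p.tgt)
  obtain ⟨z, hz⟩ := p.src.2.exists_eq p.arr p.src_arr (by rw [← p.base_tgt, ← hp]; rfl)
  have hcenter : z ∈ Subgroup.center T :=
    (p.src.conj_apply_eq_self_iff z).1 ((Frame.conj_congr rfl hz _ p.src_arr).trans hp.symm)
  exact ⟨(p.src, (⟨z, hcenter⟩ : Subgroup.center T)), FrameArr.ext hz rfl⟩

lemma FrameArr.continuous_ofCenter : Continuous (ofCenter : _ → G.FrameArr T) :=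
  continuous_mk (continuous_prod_of_discrete_right.2 fun z => Frame.continuous_apply (z.out : T))
    continuous_fst _

variable [hG : G.IsOrbifold] [Finite T] (hPI : G.IsPurelyIneffective)

lemma contMDiff_frameAct :
    ContMDiff (M := frameMfd T hPI × (K × Disc (MulAut T))) (M' := frameMfd T hPI)
      ((frameMfd T hPI).I.prod (IK.prod Disc.model)) (frameMfd T hPI).I ∞
      (fun p => Frame.act α p.1 p.2) := by
  refine contMDiff_frameMfd hPI (N := frameMfd T hPI × (K × Disc (MulAut T)))
    (Frame.continuous_act α) ?_
  have hbase := α.smooth_obj.comp (((isLocalDiffeomorph_frameBase (T := T) hPI).contMDiff.comp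
    (contMDiff_fst (I := (frameMfd T hPI).I) (J := IK.prod Disc.model)
      (N := K × Disc (MulAut T)))).prodMk (contMDiff_fst.comp contMDiff_snd))
  exact hbase.congr fun p => Frame.base_act α _ _

lemma contMDiff_frameArrAct :
    ContMDiff (M := frameArrMfd T hPI × (K × Disc (MulAut T))) (M' := frameArrMfd T hPI)
      ((frameArrMfd T hPI).I.prod (IK.prod Disc.model)) (frameArrMfd T hPI).I ∞
      (fun p => FrameArr.act α p.1 p.2) := by
  refine contMDiff_frameArrMfd hPI (N := frameArrMfd T hPI × (K × Disc (MulAut T)))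
    (FrameArr.continuous_act α) ?_
  have hbase := α.smooth_obj.comp (((isLocalDiffeomorph_frameArrBase (T := T) hPI).contMDiff.comp
    (contMDiff_fst (I := (frameArrMfd T hPI).I) (J := IK.prod Disc.model)
      (N := K × Disc (MulAut T)))).prodMk (contMDiff_fst.comp contMDiff_snd))
  exact hbase.congr fun p => Frame.base_act α _ _

variable (T) in
/-- The right action of `K × Aut T` on the frame groupoid. -/
def frameAction : (frameGroupoid T hPI).RightAction (IK.prod Disc.model)
    (K × Disc (MulAut T)) where
  obj := Frame.act α
  arr := FrameArr.act α
  obj_one := Frame.act_one α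
  obj_mul := Frame.act_mul α
  arr_one _ := FrameArr.ext (α.arr_one _) (Frame.act_one α _)
  arr_mul _ _ _ := FrameArr.ext (α.arr_mul _ _ _) (Frame.act_mul α _ _ _)
  smooth_obj := contMDiff_frameAct α hPI
  smooth_arr := contMDiff_frameArrAct α hPI
  unit_act φ k := FrameArr.ext
    ((α.unit_act _ _).trans (congrArg G.unit (Frame.base_act α φ k).symm)) rfl
  src_act _ _ := rfl
  tgt_act := FrameArr.tgt_act α
  mul_act _ _ e _ := FrameArr.ext (α.comp_act (FrameArr.src_arr_eq_of_src_eq e) _) rfl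

lemma isLocalDiffeomorph_ofCenter :
    IsLocalDiffeomorph (M := frameMfd T hPI × Disc (Subgroup.center T)) (N := frameArrMfd T hPI)
      ((frameMfd T hPI).I.prod Disc.model) (frameArrMfd T hPI).I ∞ FrameArr.ofCenter := by
  refine isLocalDiffeomorph_of_comp (M := frameMfd T hPI × Disc (Subgroup.center T))
    (N := frameArrMfd T hPI) (isLocalDiffeomorph_frameArrBase hPI) FrameArr.continuous_ofCenter ?_
  exact isLocalDiffeomorph_comp (M := frameMfd T hPI × Disc (Subgroup.center T))
    (N := frameMfd T hPI) (isLocalDiffeomorph_frameBase hPI) isLocalDiffeomorph_fst_of_discrete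

variable (T) in
/-- The equivariant trivialization `(φ, z) ↦ φ z` of the stabilizers of the frame groupoid by the
center of `T`. -/
def frameTrivialization : StabilizerTrivialization (frameAction T α hPI) (Subgroup.center T)
    (fun a kl => Subgroup.centerCongr (kl.2 : MulAut T)⁻¹ a) where
  toFun := FrameArr.ofCenter
  src_toFun _ _ := rfl
  tgt_toFun x a := FrameArr.tgt_ofCenter (x, a)
  localDiffeo := isLocalDiffeomorph_ofCenter hPI
  injective := by
    rintro ⟨φ, a⟩ ⟨ψ, b⟩ hab
    obtain rfl : φ = ψ := congrArg FrameArr.src hab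
    exact Prod.ext rfl (Subtype.ext (φ.2.injective (congrArg FrameArr.arr hab)))
  range_eq := FrameArr.range_ofCenter.trans (isPurelyIneffective_frameGroupoid hPI).symm
  map_mul (φ : G.Frame T) a b := FrameArr.ext (φ.map_mul _ _) rfl
  conj (p : G.FrameArr T) (a : Subgroup.center T) := by
    refine FrameArr.ext ?_ rfl
    change p.src.1 a = G.comp (G.comp (G.inv p.arr) (G.conj p.arr (p.src.1 a))) p.arr
    have e : G.src p.arr = G.tgt (p.src.1 a) := p.src_arr.trans (p.src.tgt_apply _).symm
    have e' : G.src (p.src.1 a) = G.src p.arr := (p.src.src_apply _).trans p.src_arr.symm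
    rw [comp_assoc (by rw [G.src_inv, tgt_conj e e']) (src_conj e e'), conj_comp_self e e',
      inv_comp_cancel_left e]
  equivariant (φ : G.Frame T) a kl := by
    refine FrameArr.ext ?_ rfl
    change α.arr (φ.1 a) kl.1 = α.arr (φ.1 (kl.2.out (kl.2.out⁻¹ a))) kl.1
    rw [MulAut.apply_inv_self]

end Action

section Trivialization

variable {G : SmoothGroupoid.{u}} [G.IsEtale]
  {EK : Type*} [NormedAddCommGroup EK] [NormedSpace ℝ EK] {HK : Type*} [TopologicalSpace HK]
  {IK : ModelWithCorners ℝ EK HK}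
  {K : Type*} [TopologicalSpace K] [ChartedSpace HK K] [Group K]

lemma StabilizerTrivialization.ineffStab_comm {α : G.RightAction IK K} {A : Type w} [Group A]
    {ρ : A → K → A} (c : StabilizerTrivialization α A ρ) (hA : ∀ a b : A, a * b = b * a)
    (y : G.Obj) (a b : G.ineffStab y) : a * b = b * a := by
  have exists_preimage (a : G.ineffStab y) : ∃ a' : Disc A, c.toFun (y, a') = a.1.arr := by
    obtain ⟨⟨z, a'⟩, ha⟩ : a.1.arr ∈ Set.range c.toFun := by
      rw [c.range_eq]
      exact a.2
    obtain rfl : z = y := by rw [← c.src_toFun z a', ha, a.1.src_eq]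
    exact ⟨a', ha⟩
  obtain ⟨a', ha⟩ := exists_preimage a
  obtain ⟨b', hb⟩ := exists_preimage b
  refine Subtype.ext (Stab.ext ?_)
  change G.mul a.1.arr b.1.arr _ = G.mul b.1.arr a.1.arr _
  have hmul := (c.map_mul y a' b').symm.trans
    ((congrArg (fun s => c.toFun (y, s)) (hA a' b')).trans (c.map_mul y b' a'))
  simp only [ha, hb] at hmul
  exact hmul

variable {EL : Type} [NormedAddCommGroup EL] [NormedSpace ℝ EL] [FiniteDimensional ℝ EL]
  {HL : Type} [TopologicalSpace HL]
  {IL : ModelWithCorners ℝ EL HL} [IL.Boundaryless]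
  {L : Type u} [TopologicalSpace L] [ChartedSpace HL L] [Group L] [LieGroup IL ∞ L]
  [T2Space L] [SecondCountableTopology L]

/-- Restriction of a trivialization to the first factor of a product group. -/
def StabilizerTrivialization.fst {β : G.RightAction (IK.prod IL) (K × L)} {A : Type w} [Group A]
    {ρ : A → K × L → A} (c : StabilizerTrivialization β A ρ) (ρ' : A → K → A)
    (h : ∀ a k, ρ a (k, 1) = ρ' a k) : StabilizerTrivialization β.fst A ρ' where
  toFun := c.toFun
  src_toFun := c.src_toFun
  tgt_toFun := c.tgt_toFun
  localDiffeo := c.localDiffeo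
  injective := c.injective
  range_eq := c.range_eq
  map_mul := c.map_mul
  conj := c.conj
  equivariant x a k := (c.equivariant x a (k, 1)).trans (by rw [h]; rfl)

end Trivialization

/-! ### The bibundle between the frame groupoid and `G` -/

section Bibundle

variable {G : SmoothGroupoid.{u}} {T : Type u} [Group T]

namespace Frame

lemma precomp_injective (φ : G.Frame T) : Function.Injective (fun e : MulAut T => φ.precomp e) :=
  fun _ _ h => MulEquiv.ext fun a =>
    φ.2.injective (congrArg (fun ψ : G.Frame T => ψ.1 a) h)

lemma continuous_precomp (e : MulAut T) : Continuous (fun φ : G.Frame T => φ.precomp e) :=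
  Continuous.subtype_mk (continuous_pi fun a => continuous_apply (e a)) _

lemma continuous_of_precomp_eq [Finite T] {X : Type*} [TopologicalSpace X] {a b : X → G.Frame T}
    (ha : Continuous a) (hb : Continuous b) {l : X → Disc (MulAut T)}
    (h : ∀ x, (a x).precomp (l x).out = b x) : Continuous l := by
  have hfin : Finite (Disc (MulAut T)) := inferInstanceAs (Finite (MulAut T))
  have hfiber (e : Disc (MulAut T)) : IsClosed (l ⁻¹' {e}) := by
    have heq : l ⁻¹' {e} = {x | (a x).precomp e.out = b x} := by
      refine Set.ext fun x => ⟨?_, fun hx => (a x).precomp_injective ((h x).trans hx.symm)⟩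
      rintro rfl
      exact h x
    rw [heq]
    exact isClosed_eq ((continuous_precomp _).comp ha) hb
  refine continuous_iff_isClosed.2 fun s _ => ?_
  rw [← Set.biUnion_preimage_singleton]
  exact s.toFinite.isClosed_biUnion fun e _ => hfiber e

end Frame

namespace FrameArr

/-- The left action `(g, p) ↦ p g⁻¹` of the frame groupoid on the arrows between frames. Only
the underlying arrows of `G` are required to be composable: in the semidirect product with `Aut T`
the frames at the sources of `g` and `p` differ by an automorphism of `T`. -/
def leftAct (g p : G.FrameArr T) (h : G.src p.arr = G.src g.arr) : G.FrameArr T :=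
  mk (G.comp p.arr (G.inv g.arr)) g.tgt
    (by rw [src_comp (h.trans (G.tgt_inv _).symm), G.src_inv, g.base_tgt])

/-- The right action `(p, g) ↦ g⁻¹ p` of `G` on the arrows between frames. -/
def rightAct (p : G.FrameArr T) (g : G.Arr) (h : G.tgt p.arr = G.tgt g) : G.FrameArr T :=
  mk (G.comp (G.inv g) p.arr) p.src
    (by rw [src_comp ((G.src_inv g).trans h.symm), p.src_arr])

lemma tgt_arr_leftAct (g p : G.FrameArr T) (h : G.src p.arr = G.src g.arr) :
    G.tgt (leftAct g p h).arr = G.tgt p.arr :=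
  tgt_comp (h.trans (G.tgt_inv _).symm)

lemma tgt_arr_rightAct (p : G.FrameArr T) (g : G.Arr) (h : G.tgt p.arr = G.tgt g) :
    G.tgt (rightAct p g h).arr = G.src g :=
  (tgt_comp ((G.src_inv g).trans h.symm)).trans (G.tgt_inv g)

lemma continuous_leftAct {X : Type*} [TopologicalSpace X] {a b : X → G.FrameArr T}
    (ha : Continuous a) (hb : Continuous b) (h : ∀ x, G.src (b x).arr = G.src (a x).arr) :
    Continuous (fun x => leftAct (a x) (b x) (h x)) :=
  continuous_mk (continuous_comp (continuous_arr.comp hb)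
    (G.smooth_inv.continuous.comp (continuous_arr.comp ha))
    fun x => (h x).trans (G.tgt_inv _).symm) (continuous_tgt.comp ha) _

lemma continuous_rightAct {X : Type*} [TopologicalSpace X] {a : X → G.FrameArr T}
    {b : X → G.Arr} (ha : Continuous a) (hb : Continuous b)
    (h : ∀ x, G.tgt (a x).arr = G.tgt (b x)) :
    Continuous (fun x => rightAct (a x) (b x) (h x)) :=
  continuous_mk (continuous_comp (G.smooth_inv.continuous.comp hb) (continuous_arr.comp ha)
    fun x => (G.src_inv _).trans (h x).symm) (continuous_src.comp ha) _

/-- The division `(p, q) ↦ p q⁻¹` inverting the right action of `G`. -/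
def rightDiv (p q : G.FrameArr T) : G.Arr := G.comp p.arr (G.inv q.arr)

section RightDiv

variable {p q : G.FrameArr T}

lemma src_arr_eq_of_src_eq_src (h : p.src = q.src) : G.src p.arr = G.src q.arr := by
  rw [p.src_arr, q.src_arr, h]

lemma src_rightDiv (h : p.src = q.src) : G.src (rightDiv p q) = G.tgt q.arr :=
  (src_comp ((src_arr_eq_of_src_eq_src h).trans (G.tgt_inv _).symm)).trans (G.src_inv _)

lemma tgt_rightDiv (h : p.src = q.src) : G.tgt (rightDiv p q) = G.tgt p.arr :=
  tgt_comp ((src_arr_eq_of_src_eq_src h).trans (G.tgt_inv _).symm)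

lemma rightDiv_rightAct (p : G.FrameArr T) {g : G.Arr} (h : G.tgt p.arr = G.tgt g) :
    rightDiv p (rightAct p g h) = g := by
  change G.comp p.arr (G.inv (G.comp (G.inv g) p.arr)) = g
  rw [inv_comp_rev ((G.src_inv _).trans h.symm), inv_inv, comp_inv_cancel_left h]

lemma rightAct_rightDiv (h : p.src = q.src) :
    rightAct p (rightDiv p q) (tgt_rightDiv h).symm = q := by
  have hsrc := src_arr_eq_of_src_eq_src h
  refine FrameArr.ext ?_ h
  change G.comp (G.inv (G.comp p.arr (G.inv q.arr))) p.arr = q.arr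
  rw [inv_comp_rev (hsrc.trans (G.tgt_inv _).symm), inv_inv, inv_comp_cancel_right hsrc.symm]

end RightDiv

variable (G T) in
/-- The shear map `(p, g) ↦ (p, g⁻¹ p)` of the right action of `G`. -/
def rightShear : {q : G.FrameArr T × G.Arr | G.tgt q.1.arr = G.tgt q.2} ≃
    {q : G.FrameArr T × G.FrameArr T | q.1.src = q.2.src} where
  toFun q := ⟨(q.1.1, rightAct q.1.1 q.1.2 q.2), rfl⟩
  invFun q := ⟨(q.1.1, rightDiv q.1.1 q.1.2), (tgt_rightDiv q.2).symm⟩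
  left_inv q := Subtype.ext (Prod.ext rfl (rightDiv_rightAct q.1.1 q.2))
  right_inv q := Subtype.ext (Prod.ext rfl (rightAct_rightDiv q.2))

section LeftDiv

variable (q p : G.FrameArr T) (h : G.tgt q.arr = G.tgt p.arr)

/-- The division `(q, p) ↦ q⁻¹ p` inverting the left action of the frame groupoid; its source
frame agrees with that of `p` only up to an automorphism of `T`. -/
def leftDiv : G.FrameArr T :=
  mk (G.comp (G.inv q.arr) p.arr) (q.src.conj (G.comp (G.inv p.arr) q.arr)
    (by rw [src_comp ((G.src_inv _).trans h.symm), q.src_arr])) (by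
      rw [src_comp ((G.src_inv _).trans h), Frame.base_conj,
        tgt_comp ((G.src_inv _).trans h.symm), G.tgt_inv])

lemma base_src_leftDiv : (leftDiv q p h).src.base = p.src.base := by
  rw [leftDiv, src_mk, Frame.base_conj, tgt_comp ((G.src_inv _).trans h.symm), G.tgt_inv,
    p.src_arr]

lemma src_arr_leftDiv : G.src p.arr = G.src (leftDiv q p h).arr := by
  rw [src_arr, src_arr, base_src_leftDiv]

lemma tgt_leftDiv : (leftDiv q p h).tgt = q.src := by
  have hunit : G.comp (G.comp (G.inv q.arr) p.arr) (G.comp (G.inv p.arr) q.arr) =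
      G.unit q.src.base := by
    rw [comp_assoc ((G.src_inv _).trans h)
      (by rw [tgt_comp ((G.src_inv _).trans h.symm), G.tgt_inv]), comp_inv_cancel_left h.symm,
      inv_comp, q.src_arr]
  have hsrc := (congrArg G.src hunit).trans (G.src_unit _)
  exact (Frame.conj_conj q.src (by rw [src_comp ((G.src_inv _).trans h.symm), q.src_arr])
    (leftDiv q p h).src_arr hsrc).trans
    ((Frame.conj_congr rfl hunit hsrc (G.src_unit _)).trans (q.src.conj_unit _))

lemma leftAct_leftDiv : leftAct (leftDiv q p h) p (src_arr_leftDiv q p h) = q := by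
  refine FrameArr.ext ?_ (tgt_leftDiv q p h)
  change G.comp p.arr (G.inv (G.comp (G.inv q.arr) p.arr)) = q.arr
  rw [inv_comp_rev ((G.src_inv _).trans h), inv_inv, comp_inv_cancel_left h.symm]

lemma exists_leftDivAut :
    ∃ l : Disc (MulAut T), (leftDiv q p h).src.precomp l.out = p.src := by
  obtain ⟨e, he⟩ := (leftDiv q p h).src.exists_mulEquiv p.src (base_src_leftDiv q p h)
  exact ⟨e, Subtype.ext (funext he)⟩

/-- The automorphism of `T` comparing the source frames of `leftDiv q p` and `p`. -/
def leftDivAut : Disc (MulAut T) := (exists_leftDivAut q p h).choose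

lemma precomp_leftDivAut : (leftDiv q p h).src.precomp (leftDivAut q p h).out = p.src :=
  (exists_leftDivAut q p h).choose_spec

end LeftDiv

lemma leftDiv_leftAct (g p : G.FrameArr T) (h : G.src p.arr = G.src g.arr) :
    leftDiv (leftAct g p h) p (tgt_arr_leftAct g p h) = g := by
  have hp : G.src p.arr = G.tgt (G.inv g.arr) := h.trans (G.tgt_inv _).symm
  have hg : G.src (G.inv g.arr) = g.tgt.base := by rw [G.src_inv, base_tgt]
  have hcancel : G.comp (G.inv p.arr) (G.comp p.arr (G.inv g.arr)) = G.inv g.arr :=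
    inv_comp_cancel_left hp
  refine FrameArr.ext ?_ ?_
  · change G.comp (G.inv (G.comp p.arr (G.inv g.arr))) p.arr = g.arr
    rw [inv_comp_rev hp, inv_inv, inv_comp_cancel_right h.symm]
  · exact (Frame.conj_congr (φ := g.tgt) rfl hcancel
      ((congrArg G.src hcancel).trans hg) hg).trans (g.src.conj_inv_conj g.src_arr _)

lemma continuous_leftDiv {X : Type*} [TopologicalSpace X] {a b : X → G.FrameArr T}
    (ha : Continuous a) (hb : Continuous b) (h : ∀ x, G.tgt (a x).arr = G.tgt (b x).arr) :
    Continuous (fun x => leftDiv (a x) (b x) (h x)) :=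
  have inv_comp_continuous {c d : X → G.FrameArr T} (hc : Continuous c) (hd : Continuous d)
      (e : ∀ x, G.tgt (c x).arr = G.tgt (d x).arr) :
      Continuous (fun x => G.comp (G.inv (c x).arr) (d x).arr) :=
    continuous_comp (G.smooth_inv.continuous.comp (continuous_arr.comp hc))
      (continuous_arr.comp hd) fun x => (G.src_inv _).trans (e x)
  continuous_mk (inv_comp_continuous ha hb h)
    (Frame.continuous_conj (inv_comp_continuous hb ha fun x => (h x).symm)
      (continuous_src.comp ha) _) _

section LeftShear

variable {EK : Type*} [NormedAddCommGroup EK] [NormedSpace ℝ EK] {HK : Type*} [TopologicalSpace HK]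
  {IK : ModelWithCorners ℝ EK HK}
  {K : Type*} [TopologicalSpace K] [ChartedSpace HK K] [Group K] (α : G.RightAction IK K)

variable (T) in
/-- The shear map `((g, l), p) ↦ (p g⁻¹, p)` of the left action of the semidirect product with
`Aut T`; the automorphism `l` enters only through the composability condition. -/
def leftShear :
    {q : (G.FrameArr T × Disc (MulAut T)) × G.FrameArr T |
      q.1.1.src.act α (1, q.1.2) = q.2.src} ≃
    {q : G.FrameArr T × G.FrameArr T | G.tgt q.1.arr = G.tgt q.2.arr} where
  toFun q := ⟨(leftAct q.1.1.1 q.1.2 (src_arr_eq_of_act_eq α q.2), q.1.2),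
    tgt_arr_leftAct _ _ (src_arr_eq_of_act_eq α q.2)⟩
  invFun q := ⟨((leftDiv q.1.1 q.1.2 q.2, leftDivAut q.1.1 q.1.2 q.2), q.1.2),
    (Frame.act_one_left α _ _).trans (precomp_leftDivAut q.1.1 q.1.2 q.2)⟩
  left_inv q := by
    have h := src_arr_eq_of_act_eq α q.2
    have hdiv := leftDiv_leftAct q.1.1.1 q.1.2 h
    have haut := precomp_leftDivAut (leftAct q.1.1.1 q.1.2 h) q.1.2 (tgt_arr_leftAct _ _ _)
    rw [hdiv] at haut
    exact Subtype.ext (Prod.ext (Prod.ext hdiv (q.1.1.1.src.precomp_injective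
      (haut.trans (q.2.symm.trans (Frame.act_one_left α _ _))))) rfl)
  right_inv q := Subtype.ext (Prod.ext (leftAct_leftDiv _ _ q.2) rfl)

end LeftShear

end FrameArr

end Bibundle

lemma IsEtale.isLocalDiffeomorph_tgt (G : SmoothGroupoid.{u}) [hG : G.IsEtale] :
    IsLocalDiffeomorph G.Arr.I G.Obj.I ∞ G.tgt := by
  let inversion : G.Arr ≃ₘ^∞⟮G.Arr.I, G.Arr.I⟯ G.Arr :=
    { toFun := G.inv
      invFun := G.inv
      left_inv := inv_inv
      right_inv := inv_inv
      contMDiff_toFun := G.smooth_inv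
      contMDiff_invFun := G.smooth_inv }
  rw [show G.tgt = fun g => G.src (inversion g) from funext fun g => (G.src_inv g).symm]
  exact isLocalDiffeomorph_comp hG.etale inversion.isLocalDiffeomorph

section Equivalence

variable {G : SmoothGroupoid.{u}} [hG : G.IsOrbifold] {T : Type u} [Group T] [Finite T]
  {EK : Type*} [NormedAddCommGroup EK] [NormedSpace ℝ EK] {HK : Type*} [TopologicalSpace HK]
  {IK : ModelWithCorners ℝ EK HK}
  {K : Type*} [TopologicalSpace K] [ChartedSpace HK K] [Group K] (α : G.RightAction IK K)
  (hPI : G.IsPurelyIneffective)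

lemma isLocalDiffeomorph_tgt_frameArrArr :
    IsLocalDiffeomorph (M := frameArrMfd T hPI) (frameArrMfd T hPI).I G.Obj.I ∞
      (fun p : G.FrameArr T => G.tgt p.arr) :=
  isLocalDiffeomorph_comp (M := frameArrMfd T hPI) (IsEtale.isLocalDiffeomorph_tgt G)
    (isLocalDiffeomorph_frameArrArr hPI)

variable (T) in
/-- The semidirect product of the frame groupoid with the automorphisms of `T`. -/
abbrev frameSemidirect : SmoothGroupoid.{u} := semidirect (frameAction T α hPI).snd

lemma smoothOnSubset_leftAct :
    SmoothOnSubset (M := (frameArrMfd T hPI × Disc (MulAut T)) × frameArrMfd T hPI)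
      (N := frameArrMfd T hPI)
      (((frameArrMfd T hPI).I.prod Disc.model).prod (frameArrMfd T hPI).I) (frameArrMfd T hPI).I
      {p : (G.FrameArr T × Disc (MulAut T)) × G.FrameArr T | p.1.1.src.act α (1, p.1.2) = p.2.src}
      (fun p => FrameArr.leftAct p.1.1.1 p.1.2 (FrameArr.src_arr_eq_of_act_eq α p.2)) := by
  have hc : Continuous (fun p : {p : (G.FrameArr T × Disc (MulAut T)) × G.FrameArr T |
      p.1.1.src.act α (1, p.1.2) = p.2.src} =>
      FrameArr.leftAct p.1.1.1 p.1.2 (FrameArr.src_arr_eq_of_act_eq α p.2)) :=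
    FrameArr.continuous_leftAct (continuous_fst.comp (continuous_fst.comp continuous_subtype_val))
      (continuous_snd.comp continuous_subtype_val) _
  exact smoothOnSubset_frameArrMfd
    (N := (frameArrMfd T hPI × Disc (MulAut T)) × frameArrMfd T hPI) hPI hc
    ((isLocalDiffeomorph_tgt_frameArrArr hPI).contMDiff.comp (contMDiff_fst.comp contMDiff_fst))
    fun p => (FrameArr.base_tgt p.1.1.1).symm

lemma smoothOnSubset_rightAct :
    SmoothOnSubset (M := frameArrMfd T hPI × G.Arr) (N := frameArrMfd T hPI)
      ((frameArrMfd T hPI).I.prod G.Arr.I) (frameArrMfd T hPI).I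
      {p : G.FrameArr T × G.Arr | G.tgt p.1.arr = G.tgt p.2}
      (fun p => FrameArr.rightAct p.1.1 p.1.2 p.2) := by
  have hc : Continuous (fun p : {p : G.FrameArr T × G.Arr | G.tgt p.1.arr = G.tgt p.2} =>
      FrameArr.rightAct p.1.1 p.1.2 p.2) :=
    FrameArr.continuous_rightAct (continuous_fst.comp continuous_subtype_val)
      (continuous_snd.comp continuous_subtype_val) _
  exact smoothOnSubset_frameArrMfd (N := frameArrMfd T hPI × G.Arr) hPI hc
    ((isLocalDiffeomorph_frameArrBase hPI).contMDiff.comp contMDiff_fst) fun _ => rfl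

lemma smoothOnSubset_rightDiv :
    SmoothOnSubset (M := frameArrMfd T hPI × frameArrMfd T hPI)
      ((frameArrMfd T hPI).I.prod (frameArrMfd T hPI).I) G.Arr.I
      {p : G.FrameArr T × G.FrameArr T | p.1.src = p.2.src}
      (fun p => FrameArr.rightDiv p.1.1 p.1.2) := by
  refine SmoothOnSubset.of_isLocalDiffeomorph (M := frameArrMfd T hPI × frameArrMfd T hPI)
    hG.etale ?_ ((isLocalDiffeomorph_tgt_frameArrArr hPI).contMDiff.comp contMDiff_snd)
    fun p => (FrameArr.src_rightDiv p.2).symm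
  exact continuous_comp
    (FrameArr.continuous_arr.comp (continuous_fst.comp continuous_subtype_val))
    (G.smooth_inv.continuous.comp
      (FrameArr.continuous_arr.comp (continuous_snd.comp continuous_subtype_val)))
    fun p => (FrameArr.src_arr_eq_of_src_eq_src p.2).trans (G.tgt_inv _).symm

lemma smoothOnSubset_leftDiv :
    SmoothOnSubset (M := frameArrMfd T hPI × frameArrMfd T hPI)
      (N := frameArrMfd T hPI × Disc (MulAut T))
      ((frameArrMfd T hPI).I.prod (frameArrMfd T hPI).I) ((frameArrMfd T hPI).I.prod Disc.model)
      {p : G.FrameArr T × G.FrameArr T | G.tgt p.1.arr = G.tgt p.2.arr}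
      (fun p => (FrameArr.leftDiv p.1.1 p.1.2 p.2, FrameArr.leftDivAut p.1.1 p.1.2 p.2)) := by
  have hc : Continuous (fun p : {p : G.FrameArr T × G.FrameArr T | G.tgt p.1.arr = G.tgt p.2.arr} =>
      FrameArr.leftDiv p.1.1 p.1.2 p.2) :=
    FrameArr.continuous_leftDiv (continuous_fst.comp continuous_subtype_val)
      (continuous_snd.comp continuous_subtype_val) _
  refine SmoothOnSubset.prodMk (M := frameArrMfd T hPI × frameArrMfd T hPI)
    (N := frameArrMfd T hPI) ?_ ?_
  · exact smoothOnSubset_frameArrMfd (N := frameArrMfd T hPI × frameArrMfd T hPI) hPI hc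
      ((isLocalDiffeomorph_frameArrBase hPI).contMDiff.comp contMDiff_snd)
      fun p => (FrameArr.base_src_leftDiv p.1.1 p.1.2 p.2).symm
  · refine SmoothOnSubset.of_discrete (M := frameArrMfd T hPI × frameArrMfd T hPI) ?_
    exact Frame.continuous_of_precomp_eq (FrameArr.continuous_src.comp hc)
      (FrameArr.continuous_src.comp (continuous_snd.comp continuous_subtype_val))
      fun p => FrameArr.precomp_leftDivAut p.1.1 p.1.2 p.2

variable (T) in
/-- The left action of the semidirect product on the bibundle. -/
def frameLeftSpace : (frameSemidirect T α hPI).LeftSpace (frameArrMfd T hPI) where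
  base := FrameArr.src
  act g p e := FrameArr.leftAct g.1 p (FrameArr.src_arr_eq_of_act_eq α e)
  smooth_base := (isLocalDiffeomorph_frameArrSrc hPI).contMDiff
  smooth_act := smoothOnSubset_leftAct α hPI
  base_act _ _ _ := rfl
  unit_act (p : G.FrameArr T) := by
    refine FrameArr.ext ?_ (FrameArr.tgt_unit _)
    change G.comp p.arr (G.inv (G.unit p.src.base)) = p.arr
    rw [inv_unit, comp_unit p.src_arr]
  act_act (g : G.FrameArr T × Disc (MulAut T)) (h : G.FrameArr T × Disc (MulAut T))
      (p : G.FrameArr T) (e : g.1.src.act α (1, g.2) = h.1.tgt) e' := by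
    have hph : G.src p.arr = G.src h.1.arr := FrameArr.src_arr_eq_of_act_eq α e'
    have hgh : G.src g.1.arr = G.tgt h.1.arr := by
      rw [← h.1.base_tgt, ← e, Frame.base_act, α.obj_one, g.1.src_arr]
    refine FrameArr.ext ?_ (FrameArr.tgt_mul g.1 (h.1.act α (1, g.2⁻¹)) ?_).symm
    · change G.comp (G.comp p.arr (G.inv h.1.arr)) (G.inv g.1.arr) =
        G.comp p.arr (G.inv (G.comp g.1.arr (α.arr h.1.arr 1)))
      rw [α.arr_one, inv_comp_rev hgh, comp_assoc (hph.trans (G.tgt_inv _).symm)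
        (by rw [G.src_inv, G.tgt_inv, hgh])]
    · rw [FrameArr.tgt_act, ← e, ← Frame.act_mul]
      simp only [Prod.mk_mul_mk, mul_one, mul_inv_cancel]
      exact (Frame.act_one α _).symm

variable (T) in
/-- The right action of `G` on the bibundle. -/
def frameRightSpace : G.RightSpace (frameArrMfd T hPI) where
  base p := G.tgt (FrameArr.arr p)
  act := FrameArr.rightAct
  smooth_base := (isLocalDiffeomorph_tgt_frameArrArr hPI).contMDiff
  smooth_act := smoothOnSubset_rightAct hPI
  base_act := FrameArr.tgt_arr_rightAct
  act_unit (p : G.FrameArr T) := by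
    refine FrameArr.ext ?_ rfl
    change G.comp (G.inv (G.unit (G.tgt p.arr))) p.arr = p.arr
    rw [inv_unit, unit_comp rfl]
  act_act (p : G.FrameArr T) g h e e' := by
    refine FrameArr.ext ?_ rfl
    change G.comp (G.inv h) (G.comp (G.inv g) p.arr) = G.comp (G.inv (G.mul g h e')) p.arr
    rw [mul_eq_comp, inv_comp_rev e', comp_assoc (by rw [G.src_inv, G.tgt_inv, e'])
      ((G.src_inv _).trans e.symm)]

lemma isPrincipal_frameRightSpace :
    (frameRightSpace T hPI).IsPrincipal (B := frameMfd T hPI) FrameArr.src := by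
  refine ⟨fun φ => ⟨FrameArr.unit φ, rfl⟩,
    .of_isLocalDiffeomorph (isLocalDiffeomorph_frameArrSrc hPI), fun _ _ _ => rfl, ?_⟩
  refine ⟨FrameArr.rightShear G T, fun _ => rfl, ?_, ?_⟩
  · exact SmoothOnSubset.prodMk (M := frameArrMfd T hPI × G.Arr) (N := frameArrMfd T hPI)
      (B := frameArrMfd T hPI) (SmoothOnSubset.of_contMDiff contMDiff_fst fun _ => rfl)
      (smoothOnSubset_rightAct hPI)
  · exact SmoothOnSubset.prodMk (M := frameArrMfd T hPI × frameArrMfd T hPI)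
      (N := frameArrMfd T hPI) (SmoothOnSubset.of_contMDiff contMDiff_fst fun _ => rfl)
      (smoothOnSubset_rightDiv hPI)

variable (T) in
/-- The bibundle from the semidirect product to `G`. -/
def frameMorphism : (frameSemidirect T α hPI).HSMorphism G where
  P := frameArrMfd T hPI
  left := frameLeftSpace T α hPI
  right := frameRightSpace T hPI
  src_invariant _ _ _ := rfl
  tgt_invariant _ _ e := FrameArr.tgt_arr_leftAct _ _ (FrameArr.src_arr_eq_of_act_eq α e)
  act_comm _ (p : G.FrameArr T) h e (e' : G.tgt p.arr = G.tgt h) := FrameArr.ext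
    (comp_assoc ((G.src_inv h).trans e'.symm)
      ((FrameArr.src_arr_eq_of_act_eq α e).trans (G.tgt_inv _).symm)).symm rfl
  principal := isPrincipal_frameRightSpace hPI

lemma isEquivalence_frameMorphism (hsurj : Function.Surjective (Frame.base : G.Frame T → G.Obj)) :
    (frameMorphism T α hPI).IsEquivalence := by
  refine ⟨fun y => ?_, .of_isLocalDiffeomorph (isLocalDiffeomorph_tgt_frameArrArr hPI),
    (frameMorphism T α hPI).tgt_invariant, ?_⟩
  · obtain ⟨φ, rfl⟩ := hsurj y
    exact ⟨FrameArr.unit φ, G.tgt_unit _⟩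
  refine ⟨FrameArr.leftShear T α, fun _ => rfl, ?_, ?_⟩
  · have hshear := (smoothOnSubset_leftAct (T := T) α hPI).prodMk
      (SmoothOnSubset.of_contMDiff (f := fun p => p.1.2) contMDiff_snd fun _ => rfl)
    exact hshear
  · have hshear_symm := (smoothOnSubset_leftDiv (T := T) hPI).prodMk
      (SmoothOnSubset.of_contMDiff (f := fun p => p.1.2) contMDiff_snd fun _ => rfl)
    exact hshear_symm

variable (T) in
/-- The bibundle from the semidirect product to `G` is `K`-equivariant. -/
def frameEquivariance :
    (frameMorphism T α hPI).Equivariance (frameAction T α hPI).onSemidirect α where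
  act p k := FrameArr.act α p (k, 1)
  act_one := (frameAction T α hPI).arr_one
  act_mul := (frameAction T α hPI).fst.arr_mul
  smooth_act := (frameAction T α hPI).fst.smooth_arr
  left_base _ _ := rfl
  right_base _ _ := α.tgt_act _ _
  left_act g (p : G.FrameArr T) e k := by
    refine FrameArr.ext ?_ (FrameArr.tgt_act α _ _).symm
    have h : G.src p.arr = G.src (FrameArr.arr g.1) := FrameArr.src_arr_eq_of_act_eq α e
    change α.arr (G.comp p.arr (G.inv (FrameArr.arr g.1))) k =
      G.comp (α.arr p.arr k) (G.inv (α.arr (FrameArr.arr g.1) k))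
    rw [α.comp_act (h.trans (G.tgt_inv _).symm), α.inv_act]
  right_act (p : G.FrameArr T) h (e : G.tgt p.arr = G.tgt h) k := by
    refine FrameArr.ext ?_ rfl
    change α.arr (G.comp (G.inv h) p.arr) k = G.comp (G.inv (α.arr h k)) (α.arr p.arr k)
    rw [α.comp_act ((G.src_inv _).trans e.symm), α.inv_act]

end Equivalence

variable {G : SmoothGroupoid.{u}}

lemma IsPurelyIneffective.ineffStab_eq_top [G.IsEtale] (hPI : G.IsPurelyIneffective) (x : G.Obj) :
    G.ineffStab x = ⊤ := by
  refine (Subgroup.eq_top_iff' _).2 fun a => ?_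
  change a.arr ∈ G.ineffectiveSpace
  rw [hPI]
  exact a.src_eq.trans a.tgt_eq.symm

lemma nonempty_ineffStab_mulEquiv_stab [G.IsOrbifold] (hconn : G.IsConnected)
    (hPI : G.IsPurelyIneffective) (x y : G.Obj) : Nonempty (G.ineffStab x ≃* G.Stab y) := by
  obtain ⟨e⟩ := hconn.nonempty_mulEquiv_stab hPI x y
  exact ⟨((MulEquiv.subgroupCongr (hPI.ineffStab_eq_top x)).trans Subgroup.topEquiv).trans e⟩

end SmoothGroupoid

end

open SmoothGroupoid in
theorem mainTheorem6_general
    {EK : Type*} [NormedAddCommGroup EK] [NormedSpace ℝ EK]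
    {HK : Type*} [TopologicalSpace HK] {IK : ModelWithCorners ℝ EK HK}
    {K : Type*} [TopologicalSpace K] [ChartedSpace HK K] [Group K]
    (G : SmoothGroupoid.{u}) [G.IsOrbifold] (hPI : G.IsPurelyIneffective)
    (α : G.RightAction IK K) (T : Type u) [Group T] [Finite T]
    (hT : ∀ y : G.Obj, Nonempty (T ≃* G.Stab y)) :
    ∃ (G' : SmoothGroupoid.{u}) (_ : G'.IsOrbifold)
      (β : G'.RightAction (IK.prod Disc.model) (K × Disc (MulAut T))),
      G'.IsPurelyIneffective ∧
      EquivariantlyEquivalent β.onSemidirect α ∧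
      Nonempty (StabilizerTrivialization β (Subgroup.center T)
        (fun a kl => Subgroup.centerCongr (kl.2 : MulAut T)⁻¹ a)) ∧
      (∀ (y : G'.Obj) (a b : G'.ineffStab y), a * b = b * a) ∧
      Nonempty (StabilizerTrivialization β.fst (Subgroup.center T) (fun a _ => a)) := by
  have hsurj : Function.Surjective (Frame.base : G.Frame T → G.Obj) :=
    fun y => nonempty_mulEquiv_stab_iff.1 (hT y)
  have hequiv : EquivariantlyEquivalent (frameAction T α hPI).onSemidirect α :=
    ⟨frameMorphism T α hPI, isEquivalence_frameMorphism α hPI hsurj, ⟨frameEquivariance T α hPI⟩⟩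
  have c := frameTrivialization T α hPI
  exact ⟨frameGroupoid T hPI, inferInstance, frameAction T α hPI,
    isPurelyIneffective_frameGroupoid hPI, hequiv, ⟨c⟩,
    c.ineffStab_comm fun a b => Subtype.ext (Subgroup.mem_center_iff.1 b.2 a.1),
    ⟨c.fst _ fun _ _ => Subtype.ext rfl⟩⟩

theorem mainTheorem6
    {EK : Type*} [NormedAddCommGroup EK] [NormedSpace ℝ EK] [FiniteDimensional ℝ EK]
    {HK : Type*} [TopologicalSpace HK] {IK : ModelWithCorners ℝ EK HK} [IK.Boundaryless]
    {K : Type*} [TopologicalSpace K] [ChartedSpace HK K] [Group K] [LieGroup IK ∞ K]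
    [T2Space K] [SecondCountableTopology K]
    (G : SmoothGroupoid.{u}) [G.IsOrbifold] (hconn : G.IsConnected)
    (hPI : G.IsPurelyIneffective) (α : G.RightAction IK K) (x : G.Obj) :
    ∃ (G' : SmoothGroupoid.{u}) (_ : G'.IsOrbifold)
      (β : G'.RightAction (IK.prod Disc.model) (K × Disc (MulAut (G.ineffStab x)))),
      G'.IsPurelyIneffective ∧
      SmoothGroupoid.EquivariantlyEquivalent β.onSemidirect α ∧
      Nonempty (SmoothGroupoid.StabilizerTrivialization β
        (Subgroup.center (G.ineffStab x))
        (fun a kl => Subgroup.centerCongr (kl.2 : MulAut (G.ineffStab x))⁻¹ a)) ∧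
      (∀ (y : G'.Obj) (a b : G'.ineffStab y), a * b = b * a) ∧
      Nonempty (SmoothGroupoid.StabilizerTrivialization β.fst
        (Subgroup.center (G.ineffStab x)) (fun a _ => a)) := by
  exact mainTheorem6_general G hPI α (G.ineffStab x)
    (SmoothGroupoid.nonempty_ineffStab_mulEquiv_stab hconn hPI x)
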